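/- Let $d\ge 3$ and let $\mathcal E=\{\pm e_1,\dots,\pm e_d\}$ be the canonical unit vectors of $\mathbb Z^d$. Configurations are elements $\omega\in\Omega=\mathcal E^{\mathbb Z^d\cup\{\star\}}$: $\omega(x)$ is the arrow at the site $x$, seen from a walker located at $0$, and $\omega(\star)$ is the arrow in the walker's hand. For $e\in\mathcal E$ define maps on $\Omega$ by $\tau_e\omega(x)=\omega(x+e)$ and $\tau_\star\omega(x)=\omega(x+\omega(\star))$ for $x\in\mathbb Z^d$, with $\tau_e\omega(\star)=\tau_\star\omega(\star)=\omega(\star)$, and let $\sigma\omega$ be $\omega$ with the values at $0$ and $\star$ exchanged. For a step map $\tau$ put $$T[\tau]f(\omega)=f(\sigma\tau\omega)-f(\omega),\qquad \widetilde T[\tau]f(\omega)=\tfrac14 f(\tau\omega)+\tfrac14 f(\sigma\tau\omega)+\tfrac14 f(\tau\sigma\omega)+\tfrac14 f(\sigma\tau\sigma\omega)-f(\omega),$$ and $U=\frac1{2d}\sum_{e\in\mathcal E}\widetilde T[\tau_e]$. For $\varepsilon>0$ the models $\mathrm{M1}_\varepsilon$ and $\mathrm{M2}_\varepsilon$ are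 the continuous-time jump processes $(\eta_t)_{t\ge0}$ on $\Omega$ with generators $T[\tau_\star]+\varepsilon U$ and $\widetilde T[\tau_\star]+\varepsilon U$ respectively. The position $X_t\in\mathbb Z^d$ of the walker starts at $X_0=0$, and each jump adds to it the step taken in that jump: $e$ for a step $\tau_e$, and the arrow in the hand at the moment of the step for a step $\tau_\star$. Let $p\in[0,1]^d$ with $\sum_i p_i=1$, and let the initial configuration $\eta_0$ have law $\pi_p$, under which all the arrows $\omega(x)$, $x\in\mathbb Z^d\cup\{\star\}$, are independent and equal to $e_i$ and to $-e_i$ with probability $\tfrac12p_i$ each, $i=1,\dots,d$. Let $E(t)=\mathbb E\,|X_t|^2$, where $|\cdot|$ is the Euclidean norm and the expectation is over both the initial configuration and the dynamics, and let $\widehat E(\lambda)=\int_0^\infty E(t)e^{-\lambda t}\,dt$. Then for every such $p$, every $\varepsilon>0$ and each of the two models $\mathrm{M1}_\varepsilon$ and $\mathrm{M2}_\varepsilon$ there are constants $C,D>0$ such that $$C\lambda^{-2}\le\widehat E(\lambda)\le D\lambda^{-2}\qquad\text{for all sufficiently small }\lambda>0,$$ and there are constants $C',D'>0$ such that $$C't\le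 E(t)\le D't\qquad\text{for all sufficiently large }t.$$ -/

import Mathlib

open MeasureTheory ProbabilityTheory Filter Topology
open scoped NNReal ENNReal

noncomputable section

namespace StoredMomentum

/-! ### Arrows, configurations, shifts and swaps -/

/-- The canonical unit vectors `± e_i` of `ℤ^d`; the pair `(i, s)` with `s = ± 1` stands for
`s • e_i`. -/
abbrev Arrow (d : ℕ) : Type := Fin d × ℤˣ

/-- The unit vector that an arrow stands for. -/
def Arrow.vec {d : ℕ} (a : Arrow d) : Fin d → ℤ := Pi.single a.1 (a.2 : ℤ)

/-- `ℤ^d ∪ {⋆}`: `some x` is the site `x`, and `none` is the placeholder `⋆` for the hand of the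
walker. -/
abbrev Site (d : ℕ) : Type := Option (Fin d → ℤ)

/-- Arrow configurations seen from the walker (the walker sits at the site `0`), together with the
arrow in the hand. It carries the product sigma-algebra. -/
abbrev Env (d : ℕ) : Type := Site d → Arrow d

/-- The shift `τ_e`: the environment seen after a step in direction `e`. -/
def shift {d : ℕ} (e : Arrow d) (ω : Env d) : Env d
  | none => ω none
  | some x => ω (some (x + e.vec))

/-- The shift `τ_⋆`: the environment seen after a step in the direction of the hand arrow. -/
def shiftHand {d : ℕ} (ω : Env d) : Env d
  | none => ω none
  | some x => ω (some (x + (ω none).vec))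

/-- The map `σ`, which exchanges the hand arrow and the arrow at the walker's site. -/
def swap {d : ℕ} (ω : Env d) : Env d
  | none => ω (some 0)
  | some x => if x = 0 then ω none else ω (some x)

/-! ### Generators -/

/-- `T[τ] f (ω) = f (σ τ ω) - f ω`: step, then swap. -/
def genT {d : ℕ} (τ : Env d → Env d) (f : Env d → ℝ) (ω : Env d) : ℝ :=
  f (swap (τ ω)) - f ω

/-- `T̃[τ]`: swap with probability `1/2`, step, and swap again with probability `1/2`. -/
def genTtilde {d : ℕ} (τ : Env d → Env d) (f : Env d → ℝ) (ω : Env d) : ℝ :=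
  (1 / 4) * f (τ ω) + (1 / 4) * f (swap (τ ω)) + (1 / 4) * f (τ (swap ω))
    + (1 / 4) * f (swap (τ (swap ω))) - f ω

/-- `U = (2d)⁻¹ ∑_e T̃[τ_e]`. -/
def genU {d : ℕ} (f : Env d → ℝ) (ω : Env d) : ℝ :=
  (1 / (2 * (d : ℝ))) * ∑ e : Arrow d, genTtilde (shift e) f ω

/-- The two models with ellipticity parameter `ε`. -/
inductive Model : Type
  | M1
  | M2

/-- The generator of the environment process: `T[τ_⋆] + ε U` for the first model and
`T̃[τ_⋆] + ε U` for the second. -/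
def Model.generator {d : ℕ} (M : Model) (ε : ℝ≥0) (f : Env d → ℝ) (ω : Env d) : ℝ :=
  match M with
  | .M1 => genT shiftHand f ω + (ε : ℝ) * genU f ω
  | .M2 => genTtilde shiftHand f ω + (ε : ℝ) * genU f ω

/-! ### The jump process with such a generator -/

/-- The possible jumps: swap beforehand if `swapBefore`, then take a step (along the hand arrow if
`step = none`, along `e` if `step = some e`), then swap if `swapAfter`. -/
structure Move (d : ℕ) : Type where
  step : Option (Arrow d)
  swapBefore : Bool
  swapAfter : Bool

/-- A jump is a triple. -/
def Move.equiv (d : ℕ) : Option (Arrow d) × Bool × Bool ≃ Move d where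
  toFun q := ⟨q.1, q.2.1, q.2.2⟩
  invFun m := (m.step, m.swapBefore, m.swapAfter)
  left_inv _ := rfl
  right_inv _ := rfl

instance (d : ℕ) : Fintype (Move d) := Fintype.ofEquiv _ (Move.equiv d)

instance (d : ℕ) : MeasurableSpace (Move d) := ⊤

instance (d : ℕ) : DiscreteMeasurableSpace (Move d) := ⟨fun _ => trivial⟩

/-- The environment at the moment of the step: the one before the jump, swapped if the jump says
so. -/
def Move.pre {d : ℕ} (m : Move d) (ω : Env d) : Env d := if m.swapBefore then swap ω else ω

/-- The displacement of the walker in a jump. -/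
def Move.displacement {d : ℕ} (m : Move d) (ω : Env d) : Fin d → ℤ :=
  match m.step with
  | none => (m.pre ω none).vec
  | some e => e.vec

/-- The environment seen by the walker after a jump. -/
def Move.apply {d : ℕ} (m : Move d) (ω : Env d) : Env d :=
  let ω' : Env d :=
    match m.step with
    | none => shiftHand (m.pre ω)
    | some e => shift e (m.pre ω)
  if m.swapAfter then swap ω' else ω'

/-- The rates of the jumps. In the first model the walker steps along the hand arrow and then swaps,
at rate `1`; in the second one it steps along the hand arrow at rate `1`, with each of the four
combinations of swaps equally likely. In both it steps along each of the `2d` unit vectors at rate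
`ε / (2d)`, with each of the four combinations of swaps equally likely. -/
def Model.rate {d : ℕ} (M : Model) (ε : ℝ≥0) (m : Move d) : ℝ≥0 :=
  match M, m with
  | .M1, ⟨none, b, c⟩ => if b = false ∧ c = true then 1 else 0
  | .M2, ⟨none, _, _⟩ => 1 / 4
  | _, ⟨some _, _, _⟩ => ε / (2 * (d : ℝ≥0)) * (1 / 4)

/-- The total jump rate. -/
def Model.totalRate (d : ℕ) (M : Model) (ε : ℝ≥0) : ℝ≥0 := ∑ m : Move d, M.rate ε m

/-- Sums over the jumps. -/
theorem sum_move {d : ℕ} {A : Type*} [AddCommMonoid A] (g : Move d → A) :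
    ∑ m : Move d, g m =
      (g ⟨none, true, true⟩ + g ⟨none, true, false⟩ +
        (g ⟨none, false, true⟩ + g ⟨none, false, false⟩)) +
      ∑ e : Arrow d, (g ⟨some e, true, true⟩ + g ⟨some e, true, false⟩ +
        (g ⟨some e, false, true⟩ + g ⟨some e, false, false⟩)) := by
  rw [← (Move.equiv d).sum_comp, Fintype.sum_prod_type, Fintype.sum_option]
  simp [Fintype.sum_prod_type, Move.equiv]

/-- The jumps and rates above are those that the generator prescribes. -/
theorem Model.generator_eq_sum {d : ℕ} (M : Model) (ε : ℝ≥0) (f : Env d → ℝ) (ω : Env d) :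
    M.generator ε f ω = ∑ m : Move d, (M.rate ε m : ℝ) * (f (m.apply ω) - f ω) := by
  rw [sum_move]
  have hU : (ε : ℝ) * genU f ω = ∑ e : Arrow d, (ε : ℝ) / (2 * (d : ℝ)) * genTtilde (shift e) f ω := by
    rw [genU, ← Finset.mul_sum]; ring
  cases M
  · simp only [Model.generator, hU]
    congr 1
    · simp [Model.rate, Move.apply, Move.pre, genT]
    · refine Finset.sum_congr rfl fun e _ => ?_
      simp [Model.rate, Move.apply, Move.pre, genTtilde]
      ring
  · simp only [Model.generator, hU]
    congr 1
    · simp [Model.rate, Move.apply, Move.pre, genTtilde]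
      ring
    · refine Finset.sum_congr rfl fun e _ => ?_
      simp [Model.rate, Move.apply, Move.pre, genTtilde]
      ring

/-- The total jump rate is `1 + ε`. -/
theorem Model.totalRate_eq {d : ℕ} (hd : d ≠ 0) (M : Model) (ε : ℝ≥0) :
    M.totalRate d ε = 1 + ε := by
  have hd' : (d : ℝ≥0) ≠ 0 := by exact_mod_cast hd
  rw [Model.totalRate, sum_move]
  cases M
  · simp [Model.rate]
    field_simp
    norm_num
  · simp [Model.rate]
    field_simp
    norm_num

/-- The law of the type of a jump: proportional to the rates. -/
def Model.moveLaw (d : ℕ) (M : Model) (ε : ℝ≥0) : Measure (Move d) :=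
  ∑ m : Move d, (M.rate ε m / M.totalRate d ε) • Measure.dirac m

/-- The law `μ_p` of one arrow: `± e_i` has probability `p_i / 2`. -/
def arrowLaw {d : ℕ} (p : stdSimplex ℝ (Fin d)) : Measure (Arrow d) :=
  ∑ a : Arrow d, ENNReal.ofReal (p.1 a.1 / 2) • Measure.dirac a

/-- The law `π_p` of the initial configuration: independent arrows with law `μ_p` at all sites and
in the hand. -/
def initialLaw {d : ℕ} (p : stdSimplex ℝ (Fin d)) : Measure (Env d) :=
  Measure.infinitePi fun _ : Site d => arrowLaw p

/-- Sample space of the process: the initial environment, and for each `n` the waiting time between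
the `n`-th and the `(n+1)`-st jump and the type of the `(n+1)`-st jump. -/
abbrev Sample (d : ℕ) : Type := Env d × (ℕ → ℝ × Move d)

/-- The initial environment has law `π_p`; the waiting times are exponential with the total jump rate
as parameter; the types of the jumps are drawn proportionally to the rates; all are independent. -/
def Model.law {d : ℕ} (M : Model) (ε : ℝ≥0) (p : stdSimplex ℝ (Fin d)) : Measure (Sample d) :=
  (initialLaw p).prod
    (Measure.infinitePi fun _ : ℕ =>
      (expMeasure (M.totalRate d ε : ℝ)).prod (M.moveLaw d ε))

theorem isProbabilityMeasure_arrowLaw {d : ℕ} (p : stdSimplex ℝ (Fin d)) :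
    IsProbabilityMeasure (arrowLaw p) := by
  constructor
  have h0 : ∀ i, 0 ≤ p.1 i := p.2.1
  simp only [arrowLaw, Measure.coe_finsetSum, Finset.sum_apply, Measure.smul_apply,
    measure_univ, smul_eq_mul, mul_one]
  rw [← ENNReal.ofReal_sum_of_nonneg fun a _ => div_nonneg (h0 a.1) (by norm_num),
    Fintype.sum_prod_type]
  simp [mul_div_cancel₀, p.2.2]

theorem Model.isProbabilityMeasure_moveLaw {d : ℕ} (hd : d ≠ 0) (M : Model) (ε : ℝ≥0) :
    IsProbabilityMeasure (M.moveLaw d ε) := by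
  have hne : M.totalRate d ε ≠ 0 := by
    rw [M.totalRate_eq hd]; positivity
  constructor
  have : ∑ m : Move d, ((M.rate ε m / M.totalRate d ε : ℝ≥0) : ℝ≥0∞) = 1 := by
    rw [← ENNReal.ofNNReal_finsetSum, ← Finset.sum_div]
    exact_mod_cast div_self hne
  simpa [Model.moveLaw, Measure.coe_finsetSum] using this

theorem Model.isProbabilityMeasure_law {d : ℕ} (hd : d ≠ 0) (M : Model) (ε : ℝ≥0)
    (p : stdSimplex ℝ (Fin d)) : IsProbabilityMeasure (M.law ε p) := by
  have := isProbabilityMeasure_arrowLaw p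
  have := M.isProbabilityMeasure_moveLaw hd ε
  have : IsProbabilityMeasure (expMeasure (M.totalRate d ε : ℝ)) := by
    apply isProbabilityMeasure_expMeasure
    rw [M.totalRate_eq hd]; positivity
  unfold Model.law initialLaw
  infer_instance

/-- The environment seen from the walker, and the position of the walker, after `n` jumps. The walker
starts at the origin. -/
def chain {d : ℕ} (w : Sample d) : ℕ → Env d × (Fin d → ℤ)
  | 0 => (w.1, 0)
  | n + 1 =>
    ((w.2 n).2.apply (chain w n).1, (chain w n).2 + (w.2 n).2.displacement (chain w n).1)

/-- The time of the `n`-th jump. -/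
def jumpTime {d : ℕ} (w : Sample d) (n : ℕ) : ℝ := ∑ k ∈ Finset.range n, (w.2 k).1

/-- The number of jumps up to time `t` (it is finite with probability one). -/
def numJumps {d : ℕ} (w : Sample d) (t : ℝ) : ℕ := {n : ℕ | jumpTime w (n + 1) ≤ t}.ncard

/-- The environment `η_t` seen from the walker at time `t`. -/
def environment {d : ℕ} (w : Sample d) (t : ℝ) : Env d := (chain w (numJumps w t)).1

/-- The position `X_t` of the walker at time `t`. -/
def position {d : ℕ} (w : Sample d) (t : ℝ) : Fin d → ℤ := (chain w (numJumps w t)).2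

/-! ### The mean-square displacement -/

/-- `E(t) = 𝔼 |X_t|²` with the Euclidean norm, as an element of `[0, ∞]`, so that a bound from above
includes finiteness. -/
def meanSquareDisplacement {d : ℕ} (M : Model) (ε : ℝ≥0) (p : stdSimplex ℝ (Fin d)) (t : ℝ) :
    ℝ≥0∞ :=
  ∫⁻ w, ENNReal.ofReal (∑ i, (position w t i : ℝ) ^ 2) ∂(M.law ε p)

/-- The Laplace transform `Ê(lam) = ∫_0^∞ E(t) exp(-lam t) dt`, as an element of `[0, ∞]`. -/
def laplaceMSD {d : ℕ} (M : Model) (ε : ℝ≥0) (p : stdSimplex ℝ (Fin d)) (lam : ℝ) : ℝ≥0∞ :=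
  ∫⁻ t in Set.Ioi (0 : ℝ),
    meanSquareDisplacement M ε p t * ENNReal.ofReal (Real.exp (-lam * t))

end StoredMomentum

end

/-! Seen from the walker, the law `initialLaw p` is invariant under each single move: shifts, swaps
and the step along the hand arrow only permute independent, identically distributed arrows. The
total jump rate is constant, so the jump times are independent of the environment and of the types
of the moves. Hence `E(t)` is the mean of `a (jumpCount t)`, where `a n` is the second moment of the
embedded discrete walk after `n` moves. It is enough to bound `a n` above and below by multiples of
`n` and to control the number of jumps by exponential moments. The Laplace bounds then follow by
integration.

Upper bound (`integral_walk_sq_le`). Let `φ` be the drift and `Q` the averaging operator of the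
moves. With `u` solving `(1 + lam) u = φ + Q u` at `lam = 1/n`, the walk is a martingale plus terms
in `u`. All of these have second moment of order `n` as soon as `(∫ φ u)² ≤ K * energy u`.
Reversibility plays no role.

This `H₋₁` bound (`Model.exists_sq_integral_drift_le`) is where `d ≥ 3` enters. The drift is a
combination of the arrows in the hand and at the origin, because opposite steps of `U` cancel. Put
`g x = ∫ ω(x)_i u`. By the Bessel inequality the gradient of `g` is controlled by the differences `u
∘ τ_e - u`, which `ε U` contributes to the energy. A Hardy inequality on `ℤ^d` (`hardy_inequality`)
bounds `g 0` by that gradient. The hand arrow differs from the arrow at the origin by a swap, which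
`ε U` controls too.

Lower bound (`exists_le_integral_walk_sq`). The gradient of a stationary function has mean zero
along each move, so it cannot cancel the constant displacement of a move of `ε U`. This keeps the
corrected increments nondegenerate, even when some `p_i` vanish, and gives linear growth of the Abel
means of `a`. Stationarity makes `√a` subadditive, and a Tauberian argument
(`exists_linear_lower_bound`) passes to `a n` itself. -/

namespace StoredMomentum

/-! ### Product measures -/

section InfinitePi

variable {ι α X : Type*} [MeasurableSpace X]

theorem measurePreserving_infinitePi_reindex (μ : Measure X) [IsProbabilityMeasure μ]
    (e : α → ι) (he : Function.Injective e) :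
    MeasurePreserving (fun (x : ι → X) a => x (e a)) (Measure.infinitePi fun _ : ι => μ)
      (Measure.infinitePi fun _ : α => μ) :=
  ⟨by fun_prop, Measure.map_infinitePi_infinitePi_of_inj he⟩

/-- Independence of the coordinate `n` from the others, in the form used below: resampling it does
not change the law. It suffices to compare boxes, where the factor at `n` moves from the first
component to the second. -/
theorem measurePreserving_infinitePi_update [DecidableEq ι] (μ : Measure X)
    [IsProbabilityMeasure μ] (n : ι) :
    MeasurePreserving (fun z : (ι → X) × X => Function.update z.1 n z.2)
      ((Measure.infinitePi fun _ : ι => μ).prod μ) (Measure.infinitePi fun _ : ι => μ) := by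
  have hm : Measurable (fun z : (ι → X) × X => Function.update z.1 n z.2) := by
    refine measurable_pi_iff.2 fun i => ?_
    by_cases h : i = n
    · subst h; simpa using measurable_snd
    · simp only [Function.update_of_ne h]; fun_prop
  refine ⟨hm, Measure.eq_infinitePi _ fun s t ht => ?_⟩
  rw [Measure.map_apply hm (.pi s.countable_toSet fun _ _ => ht _)]
  have : (fun z : (ι → X) × X => Function.update z.1 n z.2) ⁻¹' ((s : Set ι).pi t) =
      (((s.erase n : Finset ι) : Set ι).pi t) ×ˢ (if n ∈ s then t n else Set.univ) := by
    ext ⟨x, m⟩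
    simp only [Set.mem_preimage, Set.mem_pi, SetLike.mem_coe, Set.mem_prod, Finset.mem_erase]
    constructor
    · intro h
      refine ⟨fun i hi => by simpa [Function.update_of_ne hi.1] using h i hi.2, ?_⟩
      split_ifs with hn
      · simpa using h n hn
      · trivial
    · rintro ⟨h1, h2⟩ i hi
      by_cases h : i = n
      · subst h; simpa [hi] using h2
      · simpa [Function.update_of_ne h] using h1 i ⟨h, hi⟩
  rw [this, Measure.prod_prod, Measure.infinitePi_pi _ fun i _ => ht i]
  split_ifs with hn
  · rw [Finset.prod_erase_mul _ _ hn]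
  · simp [Finset.erase_eq_of_notMem hn]

/-- The sets `t i` need not be rectangles in `X × Y`, so the second sequence is integrated out
first, and the sections are independent functions of the first. -/
theorem measurePreserving_infinitePi_zip {Y : Type*} [MeasurableSpace Y] (μ : Measure X)
    (ν : Measure Y) [IsProbabilityMeasure μ] [IsProbabilityMeasure ν] :
    MeasurePreserving (fun (z : (ι → X) × (ι → Y)) i => (z.1 i, z.2 i))
      ((Measure.infinitePi fun _ : ι => μ).prod (Measure.infinitePi fun _ : ι => ν))
      (Measure.infinitePi fun _ : ι => μ.prod ν) := by
  have hm : Measurable (fun (z : (ι → X) × (ι → Y)) i => (z.1 i, z.2 i)) := by fun_prop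
  refine ⟨hm, Measure.eq_infinitePi _ fun s t ht => ?_⟩
  have hs : MeasurableSet ((s : Set ι).pi t) := .pi s.countable_toSet fun _ _ => ht _
  have hY : ∀ x : ι → X, Measure.infinitePi (fun _ : ι => ν)
      (Prod.mk x ⁻¹' ((fun (z : (ι → X) × (ι → Y)) i => (z.1 i, z.2 i)) ⁻¹' (s : Set ι).pi t)) =
      ∏ i ∈ s, ν (Prod.mk (x i) ⁻¹' t i) := fun x => by
    rw [← Measure.infinitePi_pi (μ := fun _ : ι => ν) fun i _ => measurable_prodMk_left (ht i)]
    rfl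
  have hg : ∀ i, Measurable fun y : X => ν (Prod.mk y ⁻¹' t i) := fun i =>
    measurable_measure_prodMk_left (ht i)
  rw [Measure.map_apply hm hs, Measure.prod_apply (hm hs)]
  simp only [hY]
  rw [lintegral_prod_eq_prod_lintegral_of_indepFun s
    (fun i (x : ι → X) => ν (Prod.mk (x i) ⁻¹' t i))
    (iIndepFun_infinitePi (P := fun _ : ι => μ) (X := fun i y => ν (Prod.mk y ⁻¹' t i)) hg)
    fun i => (hg i).comp (measurable_pi_apply i)]
  refine Finset.prod_congr rfl fun i _ => ?_
  rw [Measure.prod_apply (ht i),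
    ← (measurePreserving_eval_infinitePi (fun _ : ι => μ) i).lintegral_comp (hg i)]

end InfinitePi

/-! ### Bounded measurable functions -/

/-- Bounded measurable real functions. -/
structure BddMeas {Ω : Type*} [MeasurableSpace Ω] (f : Ω → ℝ) : Prop where
  meas : Measurable f
  bdd : ∃ C, ∀ x, |f x| ≤ C

namespace BddMeas

variable {Ω Ω' : Type*} [MeasurableSpace Ω] [MeasurableSpace Ω'] {f g : Ω → ℝ}

theorem const (c : ℝ) : BddMeas fun _ : Ω => c := ⟨measurable_const, |c|, fun _ => le_rfl⟩

theorem add (hf : BddMeas f) (hg : BddMeas g) : BddMeas fun x => f x + g x := by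
  obtain ⟨C, hC⟩ := hf.bdd
  obtain ⟨D, hD⟩ := hg.bdd
  exact ⟨hf.meas.add hg.meas, C + D, fun x => (abs_add_le _ _).trans (add_le_add (hC x) (hD x))⟩

theorem mul (hf : BddMeas f) (hg : BddMeas g) : BddMeas fun x => f x * g x := by
  obtain ⟨C, hC⟩ := hf.bdd
  obtain ⟨D, hD⟩ := hg.bdd
  refine ⟨hf.meas.mul hg.meas, C * D, fun x => ?_⟩
  rw [abs_mul]
  exact mul_le_mul (hC x) (hD x) (abs_nonneg _) ((abs_nonneg _).trans (hC x))

theorem const_mul (c : ℝ) (hf : BddMeas f) : BddMeas fun x => c * f x := (const c).mul hf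

theorem neg (hf : BddMeas f) : BddMeas fun x => -f x := by
  simpa using hf.const_mul (-1)

theorem sub (hf : BddMeas f) (hg : BddMeas g) : BddMeas fun x => f x - g x := by
  simpa [sub_eq_add_neg] using hf.add hg.neg

theorem sq (hf : BddMeas f) : BddMeas fun x => f x ^ 2 := by
  simpa [pow_two] using hf.mul hf

theorem sum {ι : Type*} (s : Finset ι) {F : ι → Ω → ℝ} (hF : ∀ i ∈ s, BddMeas (F i)) :
    BddMeas fun x => ∑ i ∈ s, F i x := by
  classical
  induction s using Finset.induction_on with
  | empty => simpa using const 0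
  | insert i s hi ih =>
    simp only [Finset.sum_insert hi]
    exact (hF i (by simp)).add (ih fun j hj => hF j (by simp [hj]))

theorem comp (hf : BddMeas f) {T : Ω' → Ω} (hT : Measurable T) : BddMeas fun x => f (T x) := by
  obtain ⟨C, hC⟩ := hf.bdd
  exact ⟨hf.meas.comp hT, C, fun x => hC _⟩

theorem integrable (hf : BddMeas f) (μ : Measure Ω) [IsFiniteMeasure μ] : Integrable f μ := by
  obtain ⟨C, hC⟩ := hf.bdd
  exact Integrable.of_bound hf.meas.aestronglyMeasurable C (ae_of_all _ hC)

theorem integral_right {f : Ω → Ω' → ℝ} (hf : BddMeas fun z : Ω × Ω' => f z.1 z.2)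
    (ν : Measure Ω') [IsProbabilityMeasure ν] : BddMeas fun x => ∫ y, f x y ∂ν := by
  obtain ⟨C, hC⟩ := hf.bdd
  refine ⟨hf.meas.stronglyMeasurable.integral_prod_right.measurable, C, fun x => ?_⟩
  simpa using norm_integral_le_of_norm_le_const (μ := ν) (f := f x) (C := C)
    (ae_of_all _ fun y => hC (x, y))

theorem uncurry {κ : Type*} [Finite κ] [MeasurableSpace κ] [DiscreteMeasurableSpace κ]
    {f : κ → Ω → ℝ} (hf : ∀ k, BddMeas (f k)) :
    BddMeas fun z : Ω × κ => f z.2 z.1 := by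
  have := Fintype.ofFinite κ
  choose C hC using fun k => (hf k).bdd
  refine ⟨measurable_from_prod_countable_left fun k => (hf k).meas, ∑ k, |C k|, fun z => ?_⟩
  exact ((hC _ _).trans (le_abs_self _)).trans
    (Finset.single_le_sum (f := fun k => |C k|) (fun k _ => abs_nonneg _) (Finset.mem_univ z.2))

end BddMeas

theorem sq_integral_le {Ω : Type*} [MeasurableSpace Ω] {f : Ω → ℝ} (hf : BddMeas f)
    (μ : Measure Ω) [IsProbabilityMeasure μ] : (∫ x, f x ∂μ) ^ 2 ≤ ∫ x, f x ^ 2 ∂μ := by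
  set c := ∫ y, f y ∂μ with hc
  have h : 0 ≤ ∫ x, (f x - c) ^ 2 ∂μ := integral_nonneg fun x => sq_nonneg _
  have e : ∫ x, (f x - c) ^ 2 ∂μ = ∫ x, (f x ^ 2 - (2 * c) * f x) + c ^ 2 ∂μ := by
    congr 1; ext x; ring
  rw [e, integral_add ((hf.sq.sub (hf.const_mul _)).integrable μ) (integrable_const _),
    integral_sub (hf.sq.integrable μ) ((hf.const_mul _).integrable μ), integral_const_mul, ← hc] at h
  simp at h
  nlinarith


/-! ### Walks driven by independent measure-preserving moves -/

theorem integral_comp_measurePreserving {Ω : Type*} [MeasurableSpace Ω] {π : Measure Ω} {T : Ω → Ω}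
    (hT : MeasurePreserving T π π) {f : Ω → ℝ} (hf : BddMeas f) :
    ∫ w, f (T w) ∂π = ∫ w, f w ∂π := by
  conv_rhs => rw [← hT.map_eq]
  rw [integral_map hT.measurable.aemeasurable hf.meas.aestronglyMeasurable]

section Walk

variable {Ω κ : Type*}

/-- Make the first move, and forget it. -/
def pathShift (T : κ → Ω → Ω) (z : Ω × (ℕ → κ)) : Ω × (ℕ → κ) :=
  (T (z.2 0) z.1, fun k => z.2 (k + 1))

/-- The state after `n` moves. -/
def pathState (T : κ → Ω → Ω) (n : ℕ) (z : Ω × (ℕ → κ)) : Ω := ((pathShift T)^[n] z).1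

/-- The sum of the increments `d` in the first `n` moves. -/
def walk (T : κ → Ω → Ω) (d : κ → Ω → ℝ) (n : ℕ) (z : Ω × (ℕ → κ)) : ℝ :=
  birkhoffSum (pathShift T) (fun z => d (z.2 0) z.1) n z

theorem pathShift_iterate_snd (T : κ → Ω → Ω) (n k : ℕ) (z : Ω × (ℕ → κ)) :
    ((pathShift T)^[n] z).2 k = z.2 (n + k) := by
  induction n generalizing k with
  | zero => simp
  | succ n ih =>
    rw [Function.iterate_succ_apply']
    exact (ih (k + 1)).trans (congrArg z.2 (by omega))

@[simp] theorem pathState_zero (T : κ → Ω → Ω) (z : Ω × (ℕ → κ)) : pathState T 0 z = z.1 := rfl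

theorem pathState_succ (T : κ → Ω → Ω) (n : ℕ) (z : Ω × (ℕ → κ)) :
    pathState T (n + 1) z = T (z.2 n) (pathState T n z) := by
  rw [pathState, Function.iterate_succ_apply', pathShift, pathShift_iterate_snd]
  rfl

@[simp] theorem walk_zero (T : κ → Ω → Ω) (d : κ → Ω → ℝ) (z : Ω × (ℕ → κ)) :
    walk T d 0 z = 0 := rfl

theorem walk_succ (T : κ → Ω → Ω) (d : κ → Ω → ℝ) (n : ℕ) (z : Ω × (ℕ → κ)) :
    walk T d (n + 1) z = walk T d n z + d (z.2 n) (pathState T n z) := by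
  rw [walk, birkhoffSum_succ, pathShift_iterate_snd]
  rfl

theorem walk_add (T : κ → Ω → Ω) (d : κ → Ω → ℝ) (m n : ℕ) (z : Ω × (ℕ → κ)) :
    walk T d (m + n) z = walk T d m z + walk T d n ((pathShift T)^[m] z) :=
  birkhoffSum_add ..

theorem pathState_update (T : κ → Ω → Ω) {k n : ℕ} (hk : k ≤ n) (m : κ) (z : Ω × (ℕ → κ)) :
    pathState T k (z.1, Function.update z.2 n m) = pathState T k z := by
  induction k with
  | zero => rfl
  | succ k ih =>
    rw [pathState_succ, pathState_succ, ih (by omega)]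
    simp [Function.update_of_ne (show k ≠ n by omega)]

theorem walk_update (T : κ → Ω → Ω) (d : κ → Ω → ℝ) {k n : ℕ} (hk : k ≤ n) (m : κ)
    (z : Ω × (ℕ → κ)) :
    walk T d k (z.1, Function.update z.2 n m) = walk T d k z := by
  induction k with
  | zero => rfl
  | succ k ih =>
    rw [walk_succ, walk_succ, ih (by omega), pathState_update T (by omega)]
    simp [Function.update_of_ne (show k ≠ n by omega)]

/-- If `u` solves the resolvent equation for the drift of `d`, the increments of the last walk have
mean zero, and this is a martingale decomposition. -/
theorem walk_eq_add_walk (T : κ → Ω → Ω) (d : κ → Ω → ℝ) (u : Ω → ℝ) (lam : ℝ) (n : ℕ) (z : Ω × (ℕ → κ)) :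
    walk T d n z = u z.1 - u (pathState T n z) +
      lam * ∑ k ∈ Finset.range n, u (pathState T k z) +
      walk T (fun m w => d m w + u (T m w) - u w - lam * u w) n z := by
  induction n with
  | zero => simp
  | succ n ih =>
    rw [walk_succ, walk_succ, ih, pathState_succ, Finset.sum_range_succ]
    ring

variable [MeasurableSpace Ω] [MeasurableSpace κ] [Finite κ] [DiscreteMeasurableSpace κ]

/-- The law of the initial state and of the independent moves. -/
noncomputable abbrev pathLaw (π : Measure Ω) (ν : Measure κ) : Measure (Ω × (ℕ → κ)) :=
  π.prod (Measure.infinitePi fun _ : ℕ => ν)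

theorem measurable_uncurry_finite {β : Type*} [MeasurableSpace β] {f : κ → Ω → β}
    (hf : ∀ m, Measurable (f m)) : Measurable fun z : Ω × κ => f z.2 z.1 :=
  measurable_from_prod_countable_left hf

theorem measurable_pathShift {T : κ → Ω → Ω} (hT : ∀ m, Measurable (T m)) :
    Measurable (pathShift T) :=
  ((measurable_uncurry_finite hT).comp
    (measurable_fst.prodMk ((measurable_pi_apply 0).comp measurable_snd))).prodMk (by fun_prop)

theorem measurable_pathState {T : κ → Ω → Ω} (hT : ∀ m, Measurable (T m)) (n : ℕ) :
    Measurable (pathState T n) :=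
  measurable_fst.comp ((measurable_pathShift hT).iterate n)

theorem bddMeas_move {f : κ → Ω × (ℕ → κ) → ℝ} (hf : ∀ m, BddMeas (f m)) (n : ℕ) :
    BddMeas fun z => f (z.2 n) z :=
  (BddMeas.uncurry hf).comp (T := fun z : Ω × (ℕ → κ) => (z, z.2 n)) (by fun_prop)

theorem bddMeas_walk {T : κ → Ω → Ω} (hT : ∀ m, Measurable (T m)) {d : κ → Ω → ℝ}
    (hd : ∀ m, BddMeas (d m)) (n : ℕ) : BddMeas (walk T d n) := by
  induction n with
  | zero => exact BddMeas.const 0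
  | succ n ih =>
    have : walk T d (n + 1) = fun z => walk T d n z + d (z.2 n) (pathState T n z) :=
      funext fun z => walk_succ ..
    rw [this]
    exact ih.add (bddMeas_move (fun m => (hd m).comp (measurable_pathState hT n)) n)

variable {π : Measure Ω} {ν : Measure κ} [IsProbabilityMeasure π] [IsProbabilityMeasure ν]

theorem measurePreserving_resample (n : ℕ) :
    MeasurePreserving (fun q : (Ω × (ℕ → κ)) × κ => (q.1.1, Function.update q.1.2 n q.2))
      ((pathLaw π ν).prod ν) (pathLaw π ν) :=
  ((MeasurePreserving.id π).prod (measurePreserving_infinitePi_update ν n)).comp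
    (measurePreserving_prodAssoc π (Measure.infinitePi fun _ : ℕ => ν) ν)

/-- This takes the place of conditioning on the past: a quantity that ignores the `n`-th move can be
averaged over a fresh one. -/
theorem integral_resample {f : κ → Ω × (ℕ → κ) → ℝ} (hf : ∀ m, BddMeas (f m)) (n : ℕ)
    (hn : ∀ m k z, f m (z.1, Function.update z.2 n k) = f m z) :
    ∫ z, f (z.2 n) z ∂(pathLaw π ν) = ∫ z, ∫ m, f m z ∂ν ∂(pathLaw π ν) := by
  have h := (measurePreserving_resample (π := π) (ν := ν) n)
  have hb := bddMeas_move hf n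
  have e := integral_map (μ := (pathLaw π ν).prod ν) h.measurable.aemeasurable
    (f := fun z => f (z.2 n) z) hb.meas.aestronglyMeasurable
  rw [h.map_eq] at e
  rw [e, integral_prod _ ((hb.comp h.measurable).integrable _)]
  simp [hn]

/-- Resample the move `0`. For each fixed value of it the map is a product of two measure-preserving
maps, `T m` and the shift of the sequence of moves. -/
theorem measurePreserving_pathShift {T : κ → Ω → Ω} (hT : ∀ m, MeasurePreserving (T m) π π) :
    MeasurePreserving (pathShift T) (pathLaw π ν) (pathLaw π ν) := by
  have hm := measurable_pathShift fun m => (hT m).measurable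
  refine ⟨hm, ?_⟩
  have hre := measurePreserving_resample (π := π) (ν := ν) 0
  have h1 : Measure.map (pathShift T) (pathLaw π ν) = Measure.map
      (fun q : (Ω × (ℕ → κ)) × κ => (T q.2 q.1.1, fun k => q.1.2 (k + 1)))
      ((pathLaw π ν).prod ν) := by
    conv_lhs => rw [← hre.map_eq]
    rw [Measure.map_map hm hre.measurable]
    rfl
  have hs := measurePreserving_infinitePi_reindex ν (fun k : ℕ => k + 1) (add_left_injective 1)
  have hm' : Measurable fun q : (Ω × (ℕ → κ)) × κ => (T q.2 q.1.1, fun k => q.1.2 (k + 1)) :=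
    measurable_uncurry_finite (f := fun m (z : Ω × (ℕ → κ)) => (T m z.1, fun k => z.2 (k + 1)))
      fun m => ((hT m).measurable.comp measurable_fst).prodMk (by fun_prop)
  rw [h1]
  ext s hs'
  rw [Measure.map_apply hm' hs', Measure.prod_apply_symm (hm' hs')]
  have : ∀ m, (pathLaw π ν) ((fun z => (z, m)) ⁻¹'
      ((fun q : (Ω × (ℕ → κ)) × κ => (T q.2 q.1.1, fun k => q.1.2 (k + 1))) ⁻¹' s)) =
      pathLaw π ν s := fun m => ((hT m).prod hs).measure_preimage hs'.nullMeasurableSet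
  simp [this]

theorem integral_pathShift_iterate {T : κ → Ω → Ω} (hT : ∀ m, MeasurePreserving (T m) π π)
    {f : Ω × (ℕ → κ) → ℝ} (hf : BddMeas f) (n : ℕ) :
    ∫ z, f ((pathShift T)^[n] z) ∂(pathLaw π ν) = ∫ z, f z ∂(pathLaw π ν) := by
  have h := (measurePreserving_pathShift (ν := ν) hT).iterate n
  conv_rhs => rw [← h.map_eq]
  rw [integral_map h.measurable.aemeasurable hf.meas.aestronglyMeasurable]

theorem integral_pathState {T : κ → Ω → Ω} (hT : ∀ m, MeasurePreserving (T m) π π)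
    {f : Ω → ℝ} (hf : BddMeas f) (n : ℕ) :
    ∫ z, f (pathState T n z) ∂(pathLaw π ν) = ∫ w, f w ∂π := by
  have := integral_pathShift_iterate (ν := ν) hT (hf.comp measurable_fst) n
  rw [integral_prod _ ((hf.comp measurable_fst).integrable _)] at this
  simpa [pathState] using this

end Walk


/-- The Dirichlet form of the averaging operator of the moves. -/
noncomputable def energy {Ω κ : Type*} [MeasurableSpace Ω] [MeasurableSpace κ] (π : Measure Ω)
    (ν : Measure κ) (T : κ → Ω → Ω) (u : Ω → ℝ) : ℝ :=
  ∫ w, ∫ m, (u (T m w) - u w) ^ 2 ∂ν ∂π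

theorem energy_nonneg {Ω κ : Type*} [MeasurableSpace Ω] [MeasurableSpace κ] {π : Measure Ω}
    {ν : Measure κ} {T : κ → Ω → Ω} {u : Ω → ℝ} : 0 ≤ energy π ν T u :=
  integral_nonneg fun _ => integral_nonneg fun _ => sq_nonneg _

/-! ### Resolvent equation, martingale approximation and the upper bound. -/

section WalkBounds

variable {Ω κ : Type*} [MeasurableSpace Ω] [MeasurableSpace κ] [Finite κ]
  [DiscreteMeasurableSpace κ] {π : Measure Ω} {ν : Measure κ} [IsProbabilityMeasure π]
  [IsProbabilityMeasure ν] {T : κ → Ω → Ω} {d : κ → Ω → ℝ} {u φ : Ω → ℝ}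

theorem bddMeas_average {f : κ → Ω → ℝ} (hf : ∀ m, BddMeas (f m)) :
    BddMeas fun w => ∫ m, f m w ∂ν :=
  BddMeas.integral_right (f := fun w m => f m w) (BddMeas.uncurry hf) ν

theorem integrable_move (f : κ → ℝ) : Integrable f ν := Integrable.of_finite

theorem integral_move [Fintype κ] (f : κ → ℝ) : ∫ m, f m ∂ν = ∑ m, ν.real {m} * f m := by
  simp [integral_fintype (integrable_move f)]

theorem integral_average (hT : ∀ m, MeasurePreserving (T m) π π) {f : Ω → ℝ} (hf : BddMeas f) :
    ∫ w, ∫ m, f (T m w) ∂ν ∂π = ∫ w, f w ∂π := by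
  rw [integral_integral_swap]
  · simp [integral_comp_measurePreserving (hT _) hf]
  · exact (BddMeas.uncurry fun m => hf.comp (hT m).measurable).integrable _

/-- The resolvent equation `(1 + lam) u = φ + Q u`, where `Q` is the averaging operator of the
moves, has a bounded solution. -/
theorem exists_resolvent (hT : ∀ m, Measurable (T m)) (hφ : BddMeas φ) {lam : ℝ} (hlam : 0 < lam) :
    ∃ u : Ω → ℝ, BddMeas u ∧ ∀ w, (1 + lam) * u w = φ w + ∫ m, u (T m w) ∂ν := by
  have := Fintype.ofFinite κ
  obtain ⟨C, hC⟩ := hφ.bdd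
  set Q : (Ω → ℝ) → Ω → ℝ := fun f w => ∫ m, f (T m w) ∂ν with hQ
  set F : ℕ → Ω → ℝ := fun k => Q^[k] φ with hF
  have hF1 : ∀ k, F (k + 1) = Q (F k) := fun k => Function.iterate_succ_apply' ..
  have hFm : ∀ k, BddMeas (F k) := by
    intro k
    induction k with
    | zero => exact hφ
    | succ k ih => rw [hF1]; exact bddMeas_average fun m => ih.comp (hT m)
  have hFC : ∀ k w, |F k w| ≤ C := by
    intro k
    induction k with
    | zero => exact hC
    | succ k ih =>
      intro w
      rw [hF1]
      simpa using norm_integral_le_of_norm_le_const (μ := ν) (f := fun m => F k (T m w)) (C := C)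
        (ae_of_all _ fun m => ih _)
  set ρ : ℝ := (1 + lam)⁻¹ with hρ
  have hρ0 : 0 < ρ := by positivity
  have hρ1 : ρ < 1 := inv_lt_one_of_one_lt₀ (by linarith)
  have hρl : (1 + lam) * ρ = 1 := mul_inv_cancel₀ (by positivity)
  have hb : ∀ k w, ‖ρ ^ (k + 1) * F k w‖ ≤ ρ ^ k * C := fun k w => by
    rw [norm_mul, Real.norm_of_nonneg (by positivity)]
    exact mul_le_mul (pow_le_pow_of_le_one hρ0.le hρ1.le (by omega)) (hFC k w) (norm_nonneg _)
      (by positivity)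
  have hsC : Summable fun k => ρ ^ k * C := (summable_geometric_of_lt_one hρ0.le hρ1).mul_right C
  have hs : ∀ w, Summable fun k => ρ ^ (k + 1) * F k w := fun w =>
    Summable.of_norm_bounded hsC fun k => hb k w
  -- Neumann series for `((1 + lam) - Q)⁻¹ φ`; it converges uniformly since `Q` is a contraction in
  -- the sup norm.
  refine ⟨fun w => ∑' k, ρ ^ (k + 1) * F k w, ⟨?_, ∑' k, ρ ^ k * C, fun w => ?_⟩, fun w => ?_⟩
  · refine measurable_of_tendsto_metrizable
      (f := fun n w => ∑ k ∈ Finset.range n, ρ ^ (k + 1) * F k w)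
      (fun n => Finset.measurable_sum _ fun k _ => (hFm k).meas.const_mul _) ?_
    exact tendsto_pi_nhds.2 fun w => (hs w).hasSum.tendsto_sum_nat
  · exact tsum_of_norm_bounded hsC.hasSum fun k => hb k w
  · have h1 : ∫ m, ∑' k, ρ ^ (k + 1) * F k (T m w) ∂ν = ∑' k, ρ ^ (k + 1) * F (k + 1) w := by
      simp only [integral_move, hF1, hQ, Finset.mul_sum]
      rw [Summable.tsum_finsetSum fun m _ => ?_]
      · refine Finset.sum_congr rfl fun m _ => ?_
        rw [← tsum_mul_left]
        exact tsum_congr fun k => by ring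
      · exact ((hs (T m w)).mul_left (ν.real {m})).congr fun k => by ring
    have h2 : ∀ k, (1 + lam) * (ρ ^ (k + 1) * F k w) = ρ ^ k * F k w := fun k => by
      linear_combination (ρ ^ k * F k w) * hρl
    have hs' : Summable fun k => ρ ^ k * F k w :=
      ((hs w).mul_left (1 + lam)).congr h2
    rw [h1, ← tsum_mul_left, tsum_congr h2, hs'.tsum_eq_zero_add]
    simp [hF]

/-- By stationarity of `u²` the energy is `2 ∫ u² - 2 ∫ u * Q u`, for any `Q`, reversible or not;
then `Q u` is replaced through the equation. -/
theorem energy_resolvent (hT : ∀ m, MeasurePreserving (T m) π π) (hφ : BddMeas φ) (hu : BddMeas u)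
    {lam : ℝ} (h : ∀ w, (1 + lam) * u w = φ w + ∫ m, u (T m w) ∂ν) :
    energy π ν T u = 2 * ∫ w, φ w * u w ∂π - 2 * lam * ∫ w, u w ^ 2 ∂π := by
  have h1 : ∀ w, ∫ m, (u (T m w) - u w) ^ 2 ∂ν =
      (∫ m, u (T m w) ^ 2 ∂ν) + (2 * (φ w * u w) - (1 + 2 * lam) * u w ^ 2) := fun w => by
    have e : ∀ m, (u (T m w) - u w) ^ 2 =
        u (T m w) ^ 2 + ((-2 * u w) * u (T m w) + u w ^ 2) := fun m => by ring
    simp only [e]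
    rw [integral_add (integrable_move _) (integrable_move _),
      integral_add (integrable_move _) (integrable_move _), integral_const_mul]
    simp
    linear_combination (2 * u w) * (h w)
  have hφu := (hφ.mul hu).const_mul 2
  have hu2 := hu.sq.const_mul (1 + 2 * lam)
  simp only [energy, h1]
  rw [integral_add ((bddMeas_average fun m => (hu.sq.comp (hT m).measurable)).integrable _)
    ((hφu.sub hu2).integrable _), integral_sub (hφu.integrable _) (hu2.integrable _),
    integral_average hT hu.sq, integral_const_mul, integral_const_mul]
  ring

/-- Orthogonality of martingale increments: the cross term vanishes after averaging over the last
move, and each square has the same mean by stationarity. -/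
theorem integral_walk_sq_of_centered (hT : ∀ m, MeasurePreserving (T m) π π)
    (hd : ∀ m, BddMeas (d m)) (h0 : ∀ w, ∫ m, d m w ∂ν = 0) (n : ℕ) :
    ∫ z, walk T d n z ^ 2 ∂(pathLaw π ν) = n * ∫ w, ∫ m, d m w ^ 2 ∂ν ∂π := by
  induction n with
  | zero => simp
  | succ n ih =>
    have hTm := fun m => (hT m).measurable
    have hW := bddMeas_walk hTm hd n
    have hS := measurable_pathState hTm n
    simp only [walk_succ]
    rw [integral_resample (f := fun m z => (walk T d n z + d m (pathState T n z)) ^ 2)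
      (fun m => (hW.add ((hd m).comp hS)).sq) n
      (fun m k z => by simp only [walk_update _ _ le_rfl, pathState_update _ le_rfl])]
    have h1 : ∀ z, ∫ m, (walk T d n z + d m (pathState T n z)) ^ 2 ∂ν =
        walk T d n z ^ 2 + ∫ m, d m (pathState T n z) ^ 2 ∂ν := fun z => by
      have e : ∀ m, (walk T d n z + d m (pathState T n z)) ^ 2 =
          (walk T d n z ^ 2 + (2 * walk T d n z) * d m (pathState T n z)) +
            d m (pathState T n z) ^ 2 := fun m => by ring
      simp only [e]
      rw [integral_add (integrable_move _) (integrable_move _),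
        integral_add (integrable_move _) (integrable_move _), integral_const_mul, h0]
      simp
    have hA : BddMeas fun w => ∫ m, d m w ^ 2 ∂ν := bddMeas_average fun m => (hd m).sq
    simp only [h1]
    rw [integral_add (hW.sq.integrable _) ((hA.comp hS).integrable _), ih,
      integral_pathState hT hA]
    push_cast
    ring

/-- A walk whose drift lies in the space `H₋₁` of the averaging operator is diffusive at most. -/
theorem integral_walk_sq_le (hT : ∀ m, MeasurePreserving (T m) π π) (hd : ∀ m, BddMeas (d m))
    {K : ℝ} (hK0 : 0 ≤ K)
    (hK : ∀ u : Ω → ℝ, BddMeas u →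
      (∫ w, (∫ m, d m w ∂ν) * u w ∂π) ^ 2 ≤ K * energy π ν T u) (n : ℕ) :
    ∫ z, walk T d n z ^ 2 ∂(pathLaw π ν) ≤ (12 * (∫ w, ∫ m, d m w ^ 2 ∂ν ∂π) + 96 * K) * n := by
  rcases Nat.eq_zero_or_pos n with rfl | hn
  · simp
  have hTm := fun m => (hT m).measurable
  have hn' : (0 : ℝ) < n := by exact_mod_cast hn
  have hn1 : (1 : ℝ) ≤ n := by exact_mod_cast hn
  -- At this scale the boundary terms, the term with `lam` and the martingale all have second moment
  -- of order `n`.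
  set lam : ℝ := (n : ℝ)⁻¹ with hlam
  have hl0 : 0 < lam := by positivity
  have hl1 : lam ≤ 1 := inv_le_one_of_one_le₀ hn1
  have hln : lam * n = 1 := inv_mul_cancel₀ hn'.ne'
  have hφ : BddMeas fun w => ∫ m, d m w ∂ν := bddMeas_average hd
  obtain ⟨u, hu, hres⟩ := exists_resolvent (ν := ν) hTm hφ hl0
  have hE := energy_resolvent hT hφ hu hres
  have hE0 := energy_nonneg (π := π) (ν := ν) (T := T) (u := u)
  have hKu := hK u hu
  set A := ∫ w, (∫ m, d m w ∂ν) * u w ∂π with hA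
  set B := ∫ w, u w ^ 2 ∂π with hB
  set v := ∫ w, ∫ m, d m w ^ 2 ∂ν ∂π with hv
  have hB0 : 0 ≤ B := integral_nonneg fun w => sq_nonneg _
  have hlB : 0 ≤ lam * B := mul_nonneg hl0.le hB0
  have hA0 : 0 ≤ A := by nlinarith
  -- The energy is `2A - 2 lam B`, hence at most `2A`, and `A² ≤ K * energy` yields `A ≤ 2K`.
  -- Nonnegativity of the energy then gives `lam B ≤ A`.
  have hA2 : A ≤ 2 * K := by
    by_contra hcon
    push Not at hcon
    nlinarith [mul_nonneg hK0 hlB]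
  have hlB2 : lam * B ≤ 2 * K := by nlinarith
  have hBn : B ≤ 2 * K * n := by
    calc B = (lam * B) * n := by linear_combination (-B) * hln
      _ ≤ 2 * K * n := by gcongr
  have hE4 : energy π ν T u ≤ 4 * K := by nlinarith
  set ξ : κ → Ω → ℝ := fun m w => d m w + u (T m w) - u w - lam * u w with hξ
  have hg : ∀ m, BddMeas fun w => u (T m w) - u w := fun m => (hu.comp (hTm m)).sub hu
  have hξb : ∀ m, BddMeas (ξ m) := fun m =>
    (((hd m).add (hu.comp (hTm m))).sub hu).sub (hu.const_mul lam)
  have hξ0 : ∀ w, ∫ m, ξ m w ∂ν = 0 := fun w => by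
    simp only [hξ]
    rw [integral_sub (integrable_move _) (integrable_move _),
      integral_sub (integrable_move _) (integrable_move _),
      integral_add (integrable_move _) (integrable_move _)]
    simp
    linarith [hres w]
  have hM := integral_walk_sq_of_centered hT hξb hξ0 n
  have hV : ∫ w, ∫ m, ξ m w ^ 2 ∂ν ∂π ≤ 3 * v + 18 * K := by
    have hb1 : BddMeas fun w => ∫ m, d m w ^ 2 ∂ν := bddMeas_average fun m => (hd m).sq
    have hb2 : BddMeas fun w => ∫ m, (u (T m w) - u w) ^ 2 ∂ν :=
      bddMeas_average fun m => (hg m).sq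
    have hb3 : BddMeas fun w => lam ^ 2 * u w ^ 2 := hu.sq.const_mul _
    calc ∫ w, ∫ m, ξ m w ^ 2 ∂ν ∂π
        ≤ ∫ w, 3 * ((∫ m, d m w ^ 2 ∂ν) + (∫ m, (u (T m w) - u w) ^ 2 ∂ν)
            + lam ^ 2 * u w ^ 2) ∂π := by
          refine integral_mono ((bddMeas_average fun m => (hξb m).sq).integrable _)
            ((((hb1.add hb2).add hb3).const_mul 3).integrable _) fun w => ?_
          calc ∫ m, ξ m w ^ 2 ∂ν
              ≤ ∫ m, 3 * (d m w ^ 2 + (u (T m w) - u w) ^ 2 + lam ^ 2 * u w ^ 2) ∂ν := by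
                refine integral_mono (integrable_move _) (integrable_move _) fun m => ?_
                simp only [hξ]
                nlinarith [sq_nonneg (d m w - (u (T m w) - u w)), sq_nonneg (d m w + lam * u w),
                  sq_nonneg ((u (T m w) - u w) + lam * u w)]
            _ = _ := by
                rw [integral_const_mul, integral_add (integrable_move _) (integrable_move _),
                  integral_add (integrable_move _) (integrable_move _)]
                simp
      _ = 3 * (v + energy π ν T u + lam ^ 2 * B) := by
          rw [integral_const_mul, integral_add ((hb1.add hb2).integrable _) (hb3.integrable _),
            integral_add (hb1.integrable _) (hb2.integrable _), integral_const_mul]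
          rfl
      _ ≤ _ := by nlinarith
  have hc : ∀ k, BddMeas fun z => u (pathState T k z) := fun k =>
    hu.comp (measurable_pathState hTm k)
  have hsum : BddMeas fun z => ∑ k ∈ Finset.range n, u (pathState T k z) ^ 2 :=
    BddMeas.sum _ fun k _ => (hc k).sq
  have hMb := (bddMeas_walk hTm hξb n).sq
  have hst : ∀ k, ∫ z, u (pathState T k z) ^ 2 ∂(pathLaw π ν) = B := fun k =>
    integral_pathState hT hu.sq k
  -- The square of a sum of four terms is at most four times the sum of the squares: two boundary
  -- terms, the accumulated `lam u` and the martingale.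
  calc ∫ z, walk T d n z ^ 2 ∂(pathLaw π ν)
      ≤ ∫ z, 4 * (((u (pathState T 0 z) ^ 2 + u (pathState T n z) ^ 2) +
          lam ^ 2 * n * ∑ k ∈ Finset.range n, u (pathState T k z) ^ 2) +
          walk T ξ n z ^ 2) ∂(pathLaw π ν) := by
        refine integral_mono ((bddMeas_walk hTm hd n).sq.integrable _)
          ((((((hc 0).sq.add (hc n).sq).add (hsum.const_mul _)).add hMb).const_mul 4).integrable _)
          fun z => ?_
        have hcs : (∑ k ∈ Finset.range n, u (pathState T k z)) ^ 2 ≤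
            n * ∑ k ∈ Finset.range n, u (pathState T k z) ^ 2 := by
          simpa using sq_sum_le_card_mul_sum_sq (s := Finset.range n)
            (f := fun k => u (pathState T k z))
        have hcs' := mul_le_mul_of_nonneg_left hcs (sq_nonneg lam)
        simp only
        rw [walk_eq_add_walk T d u lam n z, pathState_zero]
        set a := u z.1
        set b := u (pathState T n z)
        set s := ∑ k ∈ Finset.range n, u (pathState T k z)
        set e := walk T ξ n z
        nlinarith [sq_nonneg (a + b), sq_nonneg (a - lam * s), sq_nonneg (a - e),
          sq_nonneg (b + lam * s), sq_nonneg (b + e), sq_nonneg (lam * s - e)]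
    _ = 4 * (((B + B) + lam ^ 2 * n * (n * B)) + n * ∫ w, ∫ m, ξ m w ^ 2 ∂ν ∂π) := by
        rw [integral_const_mul, integral_add ((((hc 0).sq.add (hc n).sq).add
            (hsum.const_mul _)).integrable _) (hMb.integrable _),
          integral_add (((hc 0).sq.add (hc n).sq).integrable _) ((hsum.const_mul _).integrable _),
          integral_add ((hc 0).sq.integrable _) ((hc n).sq.integrable _), integral_const_mul,
          integral_finsetSum _ fun k _ => (hc k).sq.integrable _, hM]
        simp only [hst, Finset.sum_const, Finset.card_range, nsmul_eq_mul]
    _ = 4 * (3 * B + n * ∫ w, ∫ m, ξ m w ^ 2 ∂ν ∂π) := by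
        linear_combination (4 * B * (lam * n + 1)) * hln
    _ ≤ 4 * (3 * (2 * K * n) + n * (3 * v + 18 * K)) := by gcongr
    _ = _ := by ring

/-- Cut the path into `k` blocks of length `n` and a remainder. By stationarity blocks of equal
length have equal second moments, and Cauchy–Schwarz does the rest. -/
theorem integral_walk_sq_add_le (hT : ∀ m, MeasurePreserving (T m) π π) (hd : ∀ m, BddMeas (d m))
    (k n r : ℕ) :
    ∫ z, walk T d (k * n + r) z ^ 2 ∂(pathLaw π ν) ≤
      2 * k ^ 2 * (∫ z, walk T d n z ^ 2 ∂(pathLaw π ν)) +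
        2 * ∫ z, walk T d r z ^ 2 ∂(pathLaw π ν) := by
  have hTm := fun m => (hT m).measurable
  have hb := bddMeas_walk hTm hd
  have hit : ∀ j, Measurable ((pathShift T)^[j]) := fun j => (measurable_pathShift hTm).iterate j
  have e : ∀ k z, walk T d (k * n) z =
      ∑ j ∈ Finset.range k, walk T d n ((pathShift T)^[j * n] z) := by
    intro k z
    induction k with
    | zero => simp
    | succ k ih => rw [Finset.sum_range_succ, ← ih, Nat.succ_mul, walk_add]
  have hsum : BddMeas fun z => ∑ j ∈ Finset.range k, walk T d n ((pathShift T)^[j * n] z) ^ 2 :=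
    BddMeas.sum _ fun j _ => ((hb n).comp (hit _)).sq
  calc ∫ z, walk T d (k * n + r) z ^ 2 ∂(pathLaw π ν)
      ≤ ∫ z, 2 * k * (∑ j ∈ Finset.range k, walk T d n ((pathShift T)^[j * n] z) ^ 2) +
          2 * walk T d r ((pathShift T)^[k * n] z) ^ 2 ∂(pathLaw π ν) := by
        refine integral_mono ((hb _).sq.integrable _) (((hsum.const_mul _).add
          (((hb r).comp (hit _)).sq.const_mul 2)).integrable _) fun z => ?_
        have hcs : (∑ j ∈ Finset.range k, walk T d n ((pathShift T)^[j * n] z)) ^ 2 ≤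
            k * ∑ j ∈ Finset.range k, walk T d n ((pathShift T)^[j * n] z) ^ 2 := by
          simpa using sq_sum_le_card_mul_sum_sq (s := Finset.range k)
            (f := fun j => walk T d n ((pathShift T)^[j * n] z))
        simp only
        rw [walk_add, e]
        nlinarith [sq_nonneg (∑ j ∈ Finset.range k, walk T d n ((pathShift T)^[j * n] z) -
          walk T d r ((pathShift T)^[k * n] z))]
    _ = _ := by
        rw [integral_add ((hsum.const_mul _).integrable _)
          ((((hb r).comp (hit _)).sq.const_mul 2).integrable _), integral_const_mul,
          integral_const_mul, integral_finsetSum _ fun j _ => ((hb n).comp (hit _)).sq.integrable _]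
        simp only [integral_pathShift_iterate hT (hb _).sq]
        simp
        ring

/-- The evolution of the second moment of the walk corrected by a solution of the resolvent
equation. -/
theorem integral_walk_add_sq_succ (hT : ∀ m, MeasurePreserving (T m) π π)
    (hd : ∀ m, BddMeas (d m)) (hu : BddMeas u) {lam : ℝ}
    (h : ∀ w, (1 + lam) * u w = (∫ m, d m w ∂ν) + ∫ m, u (T m w) ∂ν) (n : ℕ) :
    ∫ z, (walk T d (n + 1) z + u (pathState T (n + 1) z)) ^ 2 ∂(pathLaw π ν) =
      (1 + lam) * (∫ z, (walk T d n z + u (pathState T n z)) ^ 2 ∂(pathLaw π ν)) +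
        lam * (∫ w, u w ^ 2 ∂π) - lam * (∫ z, walk T d n z ^ 2 ∂(pathLaw π ν)) +
        ∫ w, ∫ m, (d m w + u (T m w) - u w) ^ 2 ∂ν ∂π := by
  have hTm := fun m => (hT m).measurable
  have hW := bddMeas_walk hTm hd n
  have hS := measurable_pathState hTm n
  have huS := hu.comp hS
  simp only [walk_succ, pathState_succ]
  rw [integral_resample
    (f := fun m z => (walk T d n z + d m (pathState T n z) + u (T m (pathState T n z))) ^ 2)
    (fun m => ((hW.add ((hd m).comp hS)).add ((hu.comp (hTm m)).comp hS)).sq) n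
    (fun m k z => by simp only [walk_update _ _ le_rfl, pathState_update _ le_rfl])]
  -- The corrected increment has mean `lam u` by the resolvent equation, and `2 (x + u) u = (x + u)²
  -- + u² - x²` turns the cross term into squares.
  have h1 : ∀ z, ∫ m, (walk T d n z + d m (pathState T n z) + u (T m (pathState T n z))) ^ 2 ∂ν =
      (((1 + lam) * (walk T d n z + u (pathState T n z)) ^ 2 + lam * u (pathState T n z) ^ 2) -
        lam * walk T d n z ^ 2) +
      ∫ m, (d m (pathState T n z) + u (T m (pathState T n z)) - u (pathState T n z)) ^ 2 ∂ν :=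
    fun z => by
      set w := pathState T n z
      set x := walk T d n z
      have e : ∀ m, (x + d m w + u (T m w)) ^ 2 =
          (((x + u w) ^ 2 - 2 * (x + u w) * u w) + 2 * (x + u w) * (d m w + u (T m w))) +
            (d m w + u (T m w) - u w) ^ 2 := fun m => by ring
      simp only [e]
      rw [integral_add (integrable_move _) (integrable_move _),
        integral_add (integrable_move _) (integrable_move _), integral_const_mul,
        integral_add (integrable_move _) (integrable_move _)]
      simp
      linear_combination (-2 * (x + u w)) * h w
  have hA : BddMeas fun w => ∫ m, (d m w + u (T m w) - u w) ^ 2 ∂ν :=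
    bddMeas_average fun m => (((hd m).add (hu.comp (hTm m))).sub hu).sq
  have b1 := (hW.add huS).sq.const_mul (1 + lam)
  have b2 := huS.sq.const_mul lam
  have b3 := hW.sq.const_mul lam
  simp only [h1]
  rw [integral_add (((b1.add b2).sub b3).integrable _) ((hA.comp hS).integrable _),
    integral_sub ((b1.add b2).integrable _) (b3.integrable _),
    integral_add (b1.integrable _) (b2.integrable _), integral_const_mul, integral_const_mul,
    integral_const_mul, integral_pathState hT hA, integral_pathState hT hu.sq]

end WalkBounds


/-! ### From Abel means to linear growth -/

theorem sum_sq_mul_geometric_le {ρ : ℝ} (h0 : 0 < ρ) (h1 : ρ < 1) (N : ℕ) :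
    ∑ j ∈ Finset.range N, ρ ^ (j + 1) * (j : ℝ) ^ 2 ≤ 2 * ρ / (1 - ρ) ^ 3 := by
  have hs := hasSum_choose_mul_geometric_of_norm_lt_one 2
    (r := ρ) (by rwa [Real.norm_of_nonneg h0.le])
  have hb := (hs.mul_left (2 * ρ))
  have h2 : ∀ j : ℕ, (j : ℝ) ^ 2 ≤ 2 * ((j + 2).choose 2 : ℝ) := fun j => by
    rw [Nat.cast_choose_two]; push_cast; nlinarith [(Nat.cast_nonneg j : (0 : ℝ) ≤ j)]
  calc ∑ j ∈ Finset.range N, ρ ^ (j + 1) * (j : ℝ) ^ 2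
      ≤ ∑ j ∈ Finset.range N, 2 * ρ * (((j + 2).choose 2 : ℝ) * ρ ^ j) := by
        refine Finset.sum_le_sum fun j _ => ?_
        have := mul_le_mul_of_nonneg_left (h2 j) (pow_nonneg h0.le (j + 1))
        calc _ ≤ _ := this
          _ = _ := by ring
    _ ≤ 2 * ρ * (1 / (1 - ρ) ^ (2 + 1)) :=
        sum_le_hasSum _ (fun j _ => by positivity) hb
    _ = _ := by ring

theorem sum_geometric_succ (lam : ℝ) (hl : 0 < lam) (N : ℕ) :
    ∑ j ∈ Finset.range N, ((1 + lam)⁻¹) ^ (j + 1) = (1 - ((1 + lam)⁻¹) ^ N) / lam := by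
  have h1 : (1 + lam)⁻¹ * (1 + lam) = 1 := inv_mul_cancel₀ (by positivity)
  rw [eq_div_iff hl.ne']
  induction N with
  | zero => simp
  | succ N ih =>
    rw [Finset.sum_range_succ, add_mul, ih, pow_succ]
    linear_combination ((1 + lam)⁻¹) ^ N * h1

/-- A Tauberian estimate: if `√a` is subadditive, `a` grows at most linearly and the Abel means of
`a` grow linearly, then `a` grows at least linearly. -/
theorem exists_linear_lower_bound {a : ℕ → ℝ} {D w : ℝ} (hD : 0 < D) (hw : 0 < w)
    (ha : ∀ n, 0 ≤ a n) (haD : ∀ n, a n ≤ D * n)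
    (hsub : ∀ k n r : ℕ, a (k * n + r) ≤ 2 * k ^ 2 * a n + 2 * a r)
    (hl : ∀ lam : ℝ, 0 < lam → lam ≤ 1 → ∃ e : ℕ → ℝ, Tendsto e atTop (𝓝 0) ∧ ∀ N,
      w * ∑ j ∈ Finset.range N, ((1 + lam)⁻¹) ^ (j + 1) ≤
        lam * ∑ j ∈ Finset.range N, ((1 + lam)⁻¹) ^ (j + 1) * a j + e N) :
    ∃ c > 0, ∃ n₁ : ℕ, ∀ n ≥ n₁, c * n ≤ a n := by
  refine ⟨w ^ 2 / (128 * D), by positivity, ⌈w / (4 * D)⌉₊ + 1, fun n hn => ?_⟩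
  have hn1 : 0 < n := by omega
  have hn0 : (0 : ℝ) < n := by exact_mod_cast hn1
  have hnw : w / (4 * D) ≤ n := (Nat.le_ceil _).trans (by exact_mod_cast (by omega))
  -- Chosen so that `2 * D * n * lam = w / 2`: the linear part of the bound on `a j` then uses up
  -- only half of `w`.
  set lam : ℝ := w / (4 * D * n) with hlam
  have hl0 : 0 < lam := by positivity
  have hl1 : lam ≤ 1 := by
    rw [hlam, div_le_one (by positivity)]
    rw [div_le_iff₀ (by positivity)] at hnw
    linarith
  obtain ⟨e, he, hN⟩ := hl lam hl0 hl1
  set ρ : ℝ := (1 + lam)⁻¹ with hρ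
  have hρ0 : 0 < ρ := by positivity
  have hρ1 : ρ < 1 := inv_lt_one_of_one_lt₀ (by linarith)
  -- Division of `j` by `n` with remainder: a small `a n` would keep every `a j` small on the scale
  -- of `n`.
  have hpt : ∀ j : ℕ, a j ≤ 2 * a n / n ^ 2 * (j : ℝ) ^ 2 + 2 * D * n := fun j => by
    have h1 := hsub (j / n) n (j % n)
    rw [mul_comm (j / n), Nat.div_add_mod] at h1
    have h2 : ((j / n : ℕ) : ℝ) ≤ j / n := Nat.cast_div_le
    have h3 : a (j % n) ≤ D * n := (haD _).trans (by
      have : ((j % n : ℕ) : ℝ) ≤ n := by exact_mod_cast (Nat.mod_lt j hn1).le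
      gcongr)
    have h4 : ((j / n : ℕ) : ℝ) ^ 2 ≤ (j / n : ℝ) ^ 2 := by gcongr
    calc a j ≤ 2 * ((j / n : ℕ) : ℝ) ^ 2 * a n + 2 * a (j % n) := h1
      _ ≤ 2 * (j / n : ℝ) ^ 2 * a n + 2 * (D * n) := by
          have := ha n
          gcongr
      _ = _ := by ring
  -- Here `1 - ρ = lam * ρ`, and `lam ≤ 1` gives `ρ ≥ 1/2`.
  have hsq : 2 * ρ / (1 - ρ) ^ 3 ≤ 8 / lam ^ 3 := by
    have : 1 - ρ = lam * ρ := by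
      have h1 : ρ * (1 + lam) = 1 := inv_mul_cancel₀ (by positivity)
      linear_combination -h1
    rw [this, div_le_div_iff₀ (by positivity) (by positivity)]
    have h5 : (1 : ℝ) / 2 ≤ ρ := by
      rw [hρ, one_div]
      exact inv_anti₀ (by positivity) (by linarith)
    have h6 : 0 ≤ 2 * lam ^ 3 * ρ := by positivity
    nlinarith [mul_le_mul_of_nonneg_left (show 1 ≤ 4 * ρ ^ 2 by nlinarith) h6]
  have hbound : ∀ N, w * ((1 - ρ ^ N) / lam) ≤
      lam * (2 * a n / n ^ 2 * (8 / lam ^ 3) + 2 * D * n * (1 / lam)) + e N := fun N => by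
    have h1 := hN N
    rw [sum_geometric_succ lam hl0] at h1
    refine h1.trans (add_le_add_left (mul_le_mul_of_nonneg_left ?_ hl0.le) _)
    calc ∑ j ∈ Finset.range N, ρ ^ (j + 1) * a j
        ≤ ∑ j ∈ Finset.range N, (2 * a n / n ^ 2 * (ρ ^ (j + 1) * (j : ℝ) ^ 2) +
            2 * D * n * ρ ^ (j + 1)) := by
          refine Finset.sum_le_sum fun j _ => ?_
          calc _ ≤ _ := mul_le_mul_of_nonneg_left (hpt j) (pow_nonneg hρ0.le _)
            _ = _ := by ring
      _ = 2 * a n / n ^ 2 * ∑ j ∈ Finset.range N, ρ ^ (j + 1) * (j : ℝ) ^ 2 +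
            2 * D * n * ((1 - ρ ^ N) / lam) := by
          rw [Finset.sum_add_distrib, ← Finset.mul_sum, ← Finset.mul_sum,
            sum_geometric_succ lam hl0]
      _ ≤ _ := by
          have := ha n
          gcongr
          · exact (sum_sq_mul_geometric_le hρ0 hρ1 N).trans hsq
          · have := pow_nonneg hρ0.le N
            linarith
  have hlim : w * ((1 - 0) / lam) ≤
      lam * (2 * a n / n ^ 2 * (8 / lam ^ 3) + 2 * D * n * (1 / lam)) + 0 := by
    refine le_of_tendsto_of_tendsto' ?_ (he.const_add _) hbound
    exact (((tendsto_pow_atTop_nhds_zero_of_lt_one hρ0.le hρ1).const_sub 1).div_const lam).const_mul w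
  have hlamn : lam * (4 * D * n) = w := by
    rw [hlam]; field_simp
  have h7 : w ≤ 16 * a n / (n ^ 2 * lam) + 2 * D * n * lam := by
    have := mul_le_mul_of_nonneg_left hlim hl0.le
    calc w = lam * (w * ((1 - 0) / lam)) := by field_simp; ring
      _ ≤ _ := this
      _ = _ := by field_simp; ring
  have h8 : w / 2 * (n ^ 2 * lam) ≤ 16 * a n := by
    rw [← le_div_iff₀ (by positivity)]
    nlinarith
  rw [div_mul_eq_mul_div, div_le_iff₀ (by positivity)]
  have h9 : w / 2 * (n ^ 2 * lam) * (8 * D) = w ^ 2 * n := by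
    linear_combination (w * n) * hlamn
  nlinarith [mul_le_mul_of_nonneg_right h8 (show 0 ≤ 8 * D by positivity)]

/-! ### The lower bound for the walk. -/

section WalkBounds

variable {Ω κ : Type*} [MeasurableSpace Ω] [MeasurableSpace κ] [Finite κ]
  [DiscreteMeasurableSpace κ] {π : Measure Ω} {ν : Measure κ} [IsProbabilityMeasure π]
  [IsProbabilityMeasure ν] {T : κ → Ω → Ω} {d : κ → Ω → ℝ} {u : Ω → ℝ}

/-- The gradient of a stationary function cannot compensate a constant increment. -/
theorem le_integral_add_grad_sq (hT : ∀ m, MeasurePreserving (T m) π π) (hd : ∀ m, BddMeas (d m))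
    (hu : BddMeas u) {m₀ : κ} {c : ℝ} (hm : ∀ w, d m₀ w = c) :
    ν.real {m₀} * c ^ 2 ≤ ∫ w, ∫ m, (d m w + u (T m w) - u w) ^ 2 ∂ν ∂π := by
  have hb : ∀ m, BddMeas fun w => d m w + u (T m w) - u w := fun m =>
    ((hd m).add (hu.comp (hT m).measurable)).sub hu
  -- Jensen's inequality: `T m₀` preserves `π`, so `u ∘ T m₀ - u` has mean zero and the mean of the
  -- whole increment is `c`.
  have h1 : c ^ 2 ≤ ∫ w, (d m₀ w + u (T m₀ w) - u w) ^ 2 ∂π := by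
    refine le_trans (le_of_eq ?_) (sq_integral_le (hb m₀) π)
    rw [integral_sub (((hd m₀).add (hu.comp (hT m₀).measurable)).integrable _) (hu.integrable _),
      integral_add ((hd m₀).integrable _) ((hu.comp (hT m₀).measurable).integrable _),
      integral_comp_measurePreserving (hT m₀) hu]
    simp [hm]
  calc ν.real {m₀} * c ^ 2 ≤ ν.real {m₀} * ∫ w, (d m₀ w + u (T m₀ w) - u w) ^ 2 ∂π := by gcongr
    _ = ∫ w, ν.real {m₀} * (d m₀ w + u (T m₀ w) - u w) ^ 2 ∂π := by rw [integral_const_mul]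
    _ ≤ _ := by
        refine integral_mono (((hb m₀).sq.const_mul _).integrable _)
          ((bddMeas_average fun m => (hb m).sq).integrable _) fun w => ?_
        have := Fintype.ofFinite κ
        rw [integral_move]
        exact Finset.single_le_sum (f := fun m => ν.real {m} * (d m w + u (T m w) - u w) ^ 2)
          (fun m _ => by positivity) (Finset.mem_univ m₀)

/-- A walk which is diffusive at most and which has a deterministic increment is diffusive. -/
theorem exists_le_integral_walk_sq (hT : ∀ m, MeasurePreserving (T m) π π)
    (hd : ∀ m, BddMeas (d m)) {D : ℝ} (hD : ∀ n : ℕ, ∫ z, walk T d n z ^ 2 ∂(pathLaw π ν) ≤ D * n)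
    {m₀ : κ} (hm₀ : 0 < ν.real {m₀}) {c : ℝ} (hc : c ≠ 0) (hm : ∀ w, d m₀ w = c) :
    ∃ c' > 0, ∃ n₁ : ℕ, ∀ n ≥ n₁, c' * n ≤ ∫ z, walk T d n z ^ 2 ∂(pathLaw π ν) := by
  have hTm := fun m => (hT m).measurable
  have hDD : ∀ n : ℕ, ∫ z, walk T d n z ^ 2 ∂(pathLaw π ν) ≤ max D 1 * n := fun n =>
    (hD n).trans (by gcongr; exact le_max_left _ _)
  refine exists_linear_lower_bound (D := max D 1) (w := ν.real {m₀} * c ^ 2) (by positivity)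
    (by positivity) (fun n => integral_nonneg fun z => sq_nonneg _) hDD
    (integral_walk_sq_add_le (ν := ν) hT hd) fun lam hl0 hl1 => ?_
  obtain ⟨u, hu, hres⟩ := exists_resolvent (ν := ν) hTm (bddMeas_average (ν := ν) hd) hl0
  have hW := le_integral_add_grad_sq (ν := ν) hT hd hu hm
  set ρ : ℝ := (1 + lam)⁻¹ with hρ
  have hρ0 : 0 < ρ := by positivity
  have hρ1 : ρ < 1 := inv_lt_one_of_one_lt₀ (by linarith)
  have hρl : ρ * (1 + lam) = 1 := inv_mul_cancel₀ (by positivity)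
  have hrec := integral_walk_add_sq_succ (ν := ν) hT hd hu hres
  set W := ∫ w, ∫ m, (d m w + u (T m w) - u w) ^ 2 ∂ν ∂π
  set B := ∫ w, u w ^ 2 ∂π with hB
  set a : ℕ → ℝ := fun n => ∫ z, walk T d n z ^ 2 ∂(pathLaw π ν) with ha
  set y : ℕ → ℝ := fun n => ∫ z, (walk T d n z + u (pathState T n z)) ^ 2 ∂(pathLaw π ν) with hy
  have hB0 : 0 ≤ B := integral_nonneg fun w => sq_nonneg _
  have hy0 : ∀ n, 0 ≤ y n := fun n => integral_nonneg fun z => sq_nonneg _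
  have hyle : ∀ n, y n ≤ 2 * max D 1 * n + 2 * B := fun n => by
    have hb := bddMeas_walk hTm hd n
    have hs := hu.comp (measurable_pathState hTm n)
    calc y n ≤ ∫ z, 2 * walk T d n z ^ 2 + 2 * u (pathState T n z) ^ 2 ∂(pathLaw π ν) := by
          refine integral_mono ((hb.add hs).sq.integrable _)
            (((hb.sq.const_mul 2).add (hs.sq.const_mul 2)).integrable _) fun z => ?_
          nlinarith [sq_nonneg (walk T d n z - u (pathState T n z))]
      _ = 2 * a n + 2 * B := by
          rw [integral_add ((hb.sq.const_mul 2).integrable _) ((hs.sq.const_mul 2).integrable _),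
            integral_const_mul, integral_const_mul, integral_pathState hT hu.sq]
      _ ≤ _ := by linarith [hDD n]
  refine ⟨fun N => ρ ^ N * y N, ?_, fun N => ?_⟩
  · have hlim : Tendsto (fun N : ℕ => 2 * max D 1 * (N * ρ ^ N) + 2 * B * ρ ^ N) atTop (𝓝 0) := by
      have h1 := (tendsto_self_mul_const_pow_of_lt_one hρ0.le hρ1).const_mul (2 * max D 1)
      have h2 := (tendsto_pow_atTop_nhds_zero_of_lt_one hρ0.le hρ1).const_mul (2 * B)
      simpa using h1.add h2
    refine squeeze_zero (fun N => mul_nonneg (by positivity) (hy0 N)) (fun N => ?_) hlim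
    calc _ ≤ ρ ^ N * (2 * max D 1 * N + 2 * B) :=
          mul_le_mul_of_nonneg_left (hyle N) (by positivity)
      _ = _ := by ring
  -- Multiplied by `ρ ^ (N + 1)`, the recursion for `y` telescopes because `ρ * (1 + lam) = 1`. The
  -- remainder `ρ ^ N * y N` tends to zero since `y` grows at most linearly.
  · have htel : ∀ N : ℕ, lam * ∑ j ∈ Finset.range N, ρ ^ (j + 1) * a j + ρ ^ N * y N =
        y 0 + (W + lam * B) * ∑ j ∈ Finset.range N, ρ ^ (j + 1) := fun N => by
      induction N with
      | zero => simp
      | succ N ih =>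
        rw [Finset.sum_range_succ, Finset.sum_range_succ]
        linear_combination ih + ρ ^ (N + 1) * hrec N + ρ ^ N * y N * hρl
    rw [htel]
    have hS : 0 ≤ ∑ j ∈ Finset.range N, ρ ^ (j + 1) := Finset.sum_nonneg fun j _ => by positivity
    have h1 : 0 ≤ lam * B := by positivity
    nlinarith [hy0 0, mul_le_mul_of_nonneg_right hW hS, mul_nonneg h1 hS]

end WalkBounds


/-! ### A Hardy inequality on `ℤ^d`, `d ≥ 3` -/

section Hardy

variable {d : ℕ}

/-- A smoothed squared distance from the origin. -/
def bulge (x : Fin d → ℤ) : ℝ := 400 + ∑ j, (x j : ℝ) ^ 2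

theorem le_bulge (x : Fin d → ℤ) : 400 ≤ bulge x :=
  le_add_of_nonneg_right (Finset.sum_nonneg fun _ _ => sq_nonneg _)

theorem bulge_add_vec (x : Fin d → ℤ) (e : Arrow d) :
    bulge (x + e.vec) = bulge x + (2 * (x e.1 : ℝ) * ((e.2 : ℤ) : ℝ) + 1) := by
  obtain ⟨i, s⟩ := e
  have hs : (((s : ℤ) : ℝ)) ^ 2 = 1 := by
    rcases Int.units_eq_one_or s with rfl | rfl <;> simp
  have h : ∀ j, (((x + Arrow.vec (i, s)) j : ℤ) : ℝ) ^ 2 =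
      (x j : ℝ) ^ 2 + if j = i then 2 * (x i : ℝ) * ((s : ℤ) : ℝ) + 1 else 0 := fun j => by
    by_cases hj : j = i
    · subst hj
      simp [Arrow.vec]
      linear_combination hs
    · simp [Arrow.vec, hj]
  simp only [bulge, h, Finset.sum_add_distrib]
  simp [add_assoc]

/-- The weights of the Hardy inequality. -/
noncomputable def hardyWeight (x y : Fin d → ℤ) : ℝ := 2 * (bulge y - bulge x) / (3 * bulge x + 5 * bulge y)

theorem abs_hardyWeight_le (x y : Fin d → ℤ) : |hardyWeight x y| ≤ 1 := by
  have hx := le_bulge x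
  have hy := le_bulge y
  rw [hardyWeight, abs_div, div_le_one (by positivity), abs_of_pos (a := 3 * bulge x + _)
    (by linarith), abs_le]
  constructor <;> linarith

/-- Ground-state substitution. The weight is `1 - r x y` with `r x y = (5 bulge x + 3 bulge y) / (3
bulge x + 5 bulge y)`, and `r x y * r y x = 1`, so the difference of the two sides is the square of
`√r a - b / √r`. This `r` is a rational approximation of `(bulge y / bulge x) ^ (-1/4)`, so the
ground state behaves like `|x| ^ (-1/2)`. -/
theorem hardyWeight_le_sq (x y : Fin d → ℤ) (a b : ℝ) :
    a ^ 2 * hardyWeight x y + b ^ 2 * hardyWeight y x ≤ (b - a) ^ 2 := by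
  have hx := le_bulge x
  have hy := le_bulge y
  have h1 : 0 < 3 * bulge x + 5 * bulge y := by linarith
  have h2 : 0 < 3 * bulge y + 5 * bulge x := by linarith
  have : (b - a) ^ 2 - (a ^ 2 * hardyWeight x y + b ^ 2 * hardyWeight y x) =
      (a * (3 * bulge y + 5 * bulge x) - b * (3 * bulge x + 5 * bulge y)) ^ 2 /
        ((3 * bulge x + 5 * bulge y) * (3 * bulge y + 5 * bulge x)) := by
    rw [hardyWeight, hardyWeight]
    field_simp
    ring
  have h3 : 0 ≤ (a * (3 * bulge y + 5 * bulge x) - b * (3 * bulge x + 5 * bulge y)) ^ 2 /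
        ((3 * bulge x + 5 * bulge y) * (3 * bulge y + 5 * bulge x)) := by positivity
  linarith

/-- A second-order Taylor bound in `bulge y - bulge x`; the exact coefficient would be `5/8`, and
`13/20` leaves room for the remainder. -/
theorem le_hardyWeight {x y : Fin d → ℤ} (h : -(1 / 20) * bulge x ≤ bulge y - bulge x) :
    ((bulge y - bulge x) * bulge x - (13 / 20) * (bulge y - bulge x) ^ 2) / (4 * bulge x ^ 2) ≤
      hardyWeight x y := by
  have hx := le_bulge x
  have hy := le_bulge y
  rw [hardyWeight, div_le_div_iff₀ (by positivity) (by linarith)]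
  have e : 2 * (bulge y - bulge x) * (4 * bulge x ^ 2) -
      ((bulge y - bulge x) * bulge x - (13 / 20) * (bulge y - bulge x) ^ 2) *
        (3 * bulge x + 5 * bulge y) =
      (bulge y - bulge x) ^ 2 * ((1 / 5) * bulge x + (13 / 4) * (bulge y - bulge x)) := by ring
  have : 0 ≤ (bulge y - bulge x) ^ 2 * ((1 / 5) * bulge x + (13 / 4) * (bulge y - bulge x)) :=
    mul_nonneg (sq_nonneg _) (by linarith)
  linarith

theorem sum_arrow {A : Type*} [AddCommMonoid A] (f : Arrow d → A) :
    ∑ e, f e = ∑ i, (f (i, 1) + f (i, -1)) := by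
  rw [Fintype.sum_prod_type]
  refine Finset.sum_congr rfl fun i _ => ?_
  rw [show (Finset.univ : Finset ℤˣ) = {1, -1} from rfl, Finset.sum_pair (by decide)]

/-- Superharmonicity of the ground state. In the sum of the Taylor bounds `bulge x` has the
coefficient `2 d - 26/5`, which is positive exactly when `d ≥ 3`. -/
theorem sum_hardyWeight_nonneg (hd : 3 ≤ d) (x : Fin d → ℤ) :
    0 ≤ ∑ e : Arrow d, hardyWeight x (x + e.vec) := by
  have hx := le_bulge x
  have hi : ∀ i, (x i : ℝ) ^ 2 ≤ bulge x - 400 := fun i => by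
    rw [bulge, add_sub_cancel_left]
    exact Finset.single_le_sum (f := fun j => (x j : ℝ) ^ 2) (fun j _ => sq_nonneg _)
      (Finset.mem_univ i)
  have hle : ∀ e : Arrow d, ((bulge (x + e.vec) - bulge x) * bulge x -
      (13 / 20) * (bulge (x + e.vec) - bulge x) ^ 2) / (4 * bulge x ^ 2) ≤
      hardyWeight x (x + e.vec) := fun e => by
    refine le_hardyWeight ?_
    rw [bulge_add_vec]
    have h1 := hi e.1
    -- The constant `400 = 20²` in `bulge` is made for this: `x_i² + 400 ≥ 40 |x_i|`, so one step
    -- lowers `bulge` by at most a twentieth.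
    rcases Int.units_eq_one_or e.2 with h | h <;> rw [h] <;> simp <;>
      nlinarith [sq_nonneg ((x e.1 : ℝ) - 20), sq_nonneg ((x e.1 : ℝ) + 20)]
  refine le_trans ?_ (Finset.sum_le_sum fun e _ => hle e)
  rw [← Finset.sum_div, sum_arrow]
  refine div_nonneg ?_ (by positivity)
  have hs : ∀ i, ((bulge (x + Arrow.vec (i, 1)) - bulge x) * bulge x -
        13 / 20 * (bulge (x + Arrow.vec (i, 1)) - bulge x) ^ 2 +
      ((bulge (x + Arrow.vec (i, -1)) - bulge x) * bulge x -
        13 / 20 * (bulge (x + Arrow.vec (i, -1)) - bulge x) ^ 2)) =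
      (2 * bulge x - 13 / 10) - 26 / 5 * (x i : ℝ) ^ 2 := fun i => by
    rw [bulge_add_vec, bulge_add_vec]
    simp
    ring
  simp only [hs, Finset.sum_sub_distrib, ← Finset.mul_sum]
  have h400 : ∑ i, (x i : ℝ) ^ 2 = bulge x - 400 := by rw [bulge]; ring
  have hd' : (3 : ℝ) ≤ d := by exact_mod_cast hd
  rw [h400]
  simp
  nlinarith

theorem sum_hardyWeight_zero (hd : 3 ≤ d) :
    1 / 300 ≤ ∑ e : Arrow d, hardyWeight 0 (0 + e.vec) := by
  have h0 : bulge (0 : Fin d → ℤ) = 400 := by simp [bulge]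
  have h : ∀ e : Arrow d, hardyWeight 0 (0 + e.vec) = 2 / 3205 := fun e => by
    rw [hardyWeight, bulge_add_vec, h0]
    norm_num
  have hd' : (3 : ℝ) ≤ d := by exact_mod_cast hd
  rw [sum_arrow]
  simp only [h]
  simp
  linarith

/-- The reversal of an arrow. -/
def Arrow.reverse (d : ℕ) : Arrow d ≃ Arrow d := (Equiv.refl _).prodCongr (Equiv.neg ℤˣ)

theorem Arrow.vec_reverse (e : Arrow d) : (Arrow.reverse d e).vec = -e.vec := by
  simp [Arrow.reverse, Arrow.vec, Pi.single_neg]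

/-- Sum the edge inequality over all directed edges. Each edge and its reversal contribute equally,
so `g x ^ 2` carries twice the total weight at `x`. That weight is nonnegative everywhere and at
least `1/300` at the origin, whence `150`. -/
theorem hardy_inequality (hd : 3 ≤ d) {g : (Fin d → ℤ) → ℝ} (hg : Summable fun x => g x ^ 2) :
    g 0 ^ 2 ≤ 150 * ∑ e : Arrow d, ∑' x, (g (x + e.vec) - g x) ^ 2 := by
  set F : Arrow d → (Fin d → ℤ) → ℝ := fun e x => g x ^ 2 * hardyWeight x (x + e.vec) with hF
  set G : Arrow d → (Fin d → ℤ) → ℝ := fun e x => (g (x + e.vec) - g x) ^ 2 with hG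
  have hw : ∀ e : Arrow d, Summable (F e) := fun e => by
    refine Summable.of_norm_bounded hg fun x => ?_
    rw [norm_mul, Real.norm_of_nonneg (sq_nonneg _)]
    exact mul_le_of_le_one_right (sq_nonneg _) (abs_hardyWeight_le _ _)
  have hsh : ∀ e : Arrow d, Summable fun x => g (x + e.vec) ^ 2 := fun e =>
    hg.comp_injective (add_left_injective e.vec)
  have hgrad : ∀ e : Arrow d, Summable (G e) := fun e => by
    refine Summable.of_nonneg_of_le (fun x => sq_nonneg _) (fun x => ?_)
      (((hsh e).add hg).mul_left 2)
    nlinarith [sq_nonneg (g (x + e.vec) + g x)]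
  have hre : ∀ e : Arrow d, Summable fun x => F (Arrow.reverse d e) (x + e.vec) := fun e =>
    (hw _).comp_injective (add_left_injective e.vec)
  have hle : ∀ e x, F e x + F (Arrow.reverse d e) (x + e.vec) ≤ G e x := fun e x => by
    have := hardyWeight_le_sq x (x + e.vec) (g x) (g (x + e.vec))
    simpa [hF, hG, Arrow.vec_reverse] using this
  have h1 : ∀ e : Arrow d, (∑' x, F e x) + (∑' x, F (Arrow.reverse d e) x) ≤ ∑' x, G e x :=
    fun e => by
      have e1 : ∑' x, F (Arrow.reverse d e) (x + e.vec) = ∑' x, F (Arrow.reverse d e) x :=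
        (Equiv.addRight e.vec).tsum_eq (F (Arrow.reverse d e))
      rw [← e1, ← (hw e).tsum_add (hre e)]
      exact ((hw e).add (hre e)).tsum_le_tsum (hle e) (hgrad e)
  have h2 := Finset.sum_le_sum fun e (_ : e ∈ Finset.univ) => h1 e
  rw [Finset.sum_add_distrib, (Arrow.reverse d).sum_comp fun e => ∑' x, F e x,
    ← Summable.tsum_finsetSum fun e _ => hw e] at h2
  have h3 : g 0 ^ 2 * (1 / 300) ≤ ∑' x, ∑ e : Arrow d, F e x := by
    have hsum : Summable fun x => ∑ e : Arrow d, F e x := summable_sum fun e _ => hw e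
    refine le_trans ?_ (hsum.le_tsum 0 fun x _ => ?_)
    · rw [← Finset.mul_sum]
      exact mul_le_mul_of_nonneg_left (sum_hardyWeight_zero hd) (sq_nonneg _)
    · rw [← Finset.mul_sum]
      exact mul_nonneg (sq_nonneg _) (sum_hardyWeight_nonneg hd x)
  linarith

end Hardy


/-! ### The law of the environment -/

section Environment

variable {d : ℕ}

instance : MeasurableSingletonClass ℤˣ :=
  ⟨fun x => ⟨{(x : ℤ)}, trivial, by ext y; simp [Units.ext_iff]⟩⟩

instance : DiscreteMeasurableSpace (Arrow d) := inferInstance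

instance (p : stdSimplex ℝ (Fin d)) : IsProbabilityMeasure (arrowLaw p) :=
  isProbabilityMeasure_arrowLaw p

instance (p : stdSimplex ℝ (Fin d)) : IsProbabilityMeasure (initialLaw p) := by
  unfold initialLaw; infer_instance

theorem shift_eq (e : Arrow d) (ω : Env d) :
    shift e ω = fun a => ω (a.map (· + e.vec)) := by
  funext a; cases a <;> rfl

theorem swap_eq (ω : Env d) : swap ω = fun a => ω (Equiv.swap none (some 0) a) := by
  funext a
  cases a with
  | none => simp [swap]
  | some x =>
    by_cases hx : x = 0
    · subst hx; simp [swap]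
    · rw [Equiv.swap_apply_of_ne_of_ne (by simp) (by simpa using hx)]
      simp [swap, hx]

theorem swap_swap (ω : Env d) : swap (swap ω) = ω := by
  rw [swap_eq (swap ω), swap_eq]
  funext a
  simp

theorem shiftHand_eq (ω : Env d) : shiftHand ω = shift (ω none) ω := by
  funext a; cases a <;> rfl

variable {p : stdSimplex ℝ (Fin d)}

theorem measurePreserving_shift (e : Arrow d) :
    MeasurePreserving (shift e) (initialLaw p) (initialLaw p) := by
  have : shift e = fun (ω : Env d) a => ω (a.map (· + e.vec)) := funext (shift_eq e)
  rw [this]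
  exact measurePreserving_infinitePi_reindex (arrowLaw p) _
    (Option.map_injective (add_left_injective e.vec))

theorem measurePreserving_swap :
    MeasurePreserving swap (initialLaw p) (initialLaw p) := by
  have : swap = fun (ω : Env d) a => ω (Equiv.swap none (some 0) a) := funext swap_eq
  rw [this]
  exact measurePreserving_infinitePi_reindex (arrowLaw p) _ (Equiv.injective _)

/-- Split according to the hand arrow, which the step does not alter: where it equals `a`, the map
is the shift by `a`. -/
theorem measurePreserving_shiftHand :
    MeasurePreserving shiftHand (initialLaw p) (initialLaw p) := by
  have hm : Measurable (shiftHand : Env d → Env d) := by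
    have : shiftHand = (fun z : Env d × Arrow d => shift z.2 z.1) ∘ fun ω => (ω, ω none) :=
      funext shiftHand_eq
    rw [this]
    exact (measurable_uncurry_finite fun e => (measurePreserving_shift (p := p) e).measurable).comp
      (by fun_prop)
  refine ⟨hm, ?_⟩
  have hsplit : ∀ A : Set (Env d), initialLaw p A =
      ∑ a : Arrow d, initialLaw p ((fun ω : Env d => ω none) ⁻¹' {a} ∩ A) := fun A => by
    have h := sum_measure_preimage_singleton (μ := (initialLaw p).restrict A) Finset.univ
      (f := fun ω : Env d => ω none)
      (fun a _ => measurableSet_preimage (measurable_pi_apply none) (measurableSet_singleton a))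
    simp only [Finset.coe_univ, Set.preimage_univ, Measure.restrict_apply MeasurableSet.univ,
      Set.univ_inter] at h
    rw [← h]
    exact Finset.sum_congr rfl fun a _ => Measure.restrict_apply
      (measurableSet_preimage (measurable_pi_apply none) (measurableSet_singleton a))
  ext s hs
  rw [Measure.map_apply hm hs, hsplit, hsplit s]
  refine Finset.sum_congr rfl fun a _ => ?_
  have hs' : MeasurableSet ((fun ω : Env d => ω none) ⁻¹' {a} ∩ s) :=
    (measurableSet_preimage (measurable_pi_apply none) (measurableSet_singleton a)).inter hs
  rw [← (measurePreserving_shift (p := p) a).measure_preimage hs'.nullMeasurableSet]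
  congr 1
  ext ω
  simp only [Set.mem_inter_iff, Set.mem_singleton_iff, Set.mem_preimage, shiftHand_eq]
  constructor
  · rintro ⟨rfl, h⟩; exact ⟨rfl, h⟩
  · rintro ⟨h1, h2⟩
    have h1' : ω none = a := h1
    exact ⟨h1', by rwa [h1']⟩

theorem measurePreserving_pre (m : Move d) :
    MeasurePreserving m.pre (initialLaw p) (initialLaw p) := by
  obtain ⟨s, b, c⟩ := m
  cases b
  · exact MeasurePreserving.id _
  · exact measurePreserving_swap

theorem measurePreserving_apply (m : Move d) :
    MeasurePreserving m.apply (initialLaw p) (initialLaw p) := by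
  have h1 : ∀ τ : Env d → Env d, MeasurePreserving τ (initialLaw p) (initialLaw p) →
      MeasurePreserving (fun ω => if m.swapAfter then swap (τ (m.pre ω)) else τ (m.pre ω))
        (initialLaw p) (initialLaw p) := fun τ hτ => by
    by_cases h : m.swapAfter
    · simp only [h, if_true]
      exact measurePreserving_swap.comp (hτ.comp (measurePreserving_pre m))
    · simp only [h]
      exact hτ.comp (measurePreserving_pre m)
  rcases hstep : m.step with _ | e
  · convert h1 _ measurePreserving_shiftHand using 1
    funext ω
    simp [Move.apply, hstep]
  · convert h1 _ (measurePreserving_shift e) using 1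
    funext ω
    simp [Move.apply, hstep]

/-! ### Coordinates of the arrows -/

/-- The `i`-th coordinate of an arrow. -/
def Arrow.coord (i : Fin d) (a : Arrow d) : ℝ := (a.vec i : ℤ)

theorem Arrow.abs_coord_le (i : Fin d) (a : Arrow d) : |a.coord i| ≤ 1 := by
  obtain ⟨j, s⟩ := a
  by_cases h : i = j
  · subst h
    rcases Int.units_eq_one_or s with rfl | rfl <;> simp [Arrow.coord, Arrow.vec]
  · simp [Arrow.coord, Arrow.vec, h]

theorem Arrow.coord_neg (i j : Fin d) :
    Arrow.coord i (j, -1) = -Arrow.coord i (j, 1) := by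
  simp [Arrow.coord, Arrow.vec, Pi.single_neg]

theorem bddMeas_coord (i : Fin d) : BddMeas (Arrow.coord i) :=
  ⟨measurable_of_countable _, 1, Arrow.abs_coord_le i⟩

theorem bddMeas_coord_site (i : Fin d) (a : Site d) : BddMeas fun ω : Env d => (ω a).coord i :=
  (bddMeas_coord i).comp (measurable_pi_apply a)

theorem integral_coord (i : Fin d) : ∫ a, Arrow.coord i a ∂(arrowLaw p) = 0 := by
  rw [arrowLaw, integral_finsetSum_measure fun a _ =>
    ((bddMeas_coord i).integrable _).smul_measure ENNReal.ofReal_ne_top, sum_arrow]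
  simp [Arrow.coord_neg]

theorem integral_coord_mul_coord (i : Fin d) {a b : Site d} (hab : a ≠ b) :
    ∫ ω, (ω a).coord i * (ω b).coord i ∂(initialLaw p) = 0 := by
  have h := Measure.infinitePi_map_eval_prod (P := fun _ : Site d => arrowLaw p) hab
  have hb : BddMeas fun z : Arrow d × Arrow d => z.1.coord i * z.2.coord i :=
    ((bddMeas_coord i).comp measurable_fst).mul ((bddMeas_coord i).comp measurable_snd)
  have e := integral_map (μ := initialLaw p) (φ := fun ω : Env d => (ω a, ω b))
    (f := fun z => z.1.coord i * z.2.coord i) (by fun_prop) hb.meas.aestronglyMeasurable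
  rw [← e, initialLaw, h, integral_prod_mul (Arrow.coord i) (Arrow.coord i), integral_coord]
  simp

/-- The Bessel inequality for the coordinates of the arrows. -/
theorem sum_sq_integral_coord_le (i : Fin d) {f : Env d → ℝ} (hf : BddMeas f)
    (s : Finset (Site d)) :
    ∑ a ∈ s, (∫ ω, (ω a).coord i * f ω ∂(initialLaw p)) ^ 2 ≤ ∫ ω, f ω ^ 2 ∂(initialLaw p) := by
  set c : Site d → ℝ := fun a => ∫ ω, (ω a).coord i * f ω ∂(initialLaw p) with hc
  have hb := bddMeas_coord_site (d := d) i
  set S : Env d → ℝ := fun ω => ∑ a ∈ s, c a * (ω a).coord i with hS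
  have hSb : BddMeas S := BddMeas.sum s fun a _ => (hb a).const_mul _
  have h1 : ∫ ω, S ω * f ω ∂(initialLaw p) = ∑ a ∈ s, c a ^ 2 := by
    simp only [hS, Finset.sum_mul, mul_assoc]
    rw [integral_finsetSum _ fun a _ => (((hb a).mul hf).const_mul _).integrable _]
    exact Finset.sum_congr rfl fun a _ => by rw [integral_const_mul, pow_two]
  have h2 : ∫ ω, S ω ^ 2 ∂(initialLaw p) ≤ ∑ a ∈ s, c a ^ 2 := by
    have e : ∀ ω, S ω ^ 2 = ∑ a ∈ s, ∑ b ∈ s, (c a * c b) * ((ω a).coord i * (ω b).coord i) :=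
      fun ω => by
        rw [pow_two, hS, Finset.sum_mul_sum]
        exact Finset.sum_congr rfl fun a _ => Finset.sum_congr rfl fun b _ => by ring
    simp only [e]
    rw [integral_finsetSum _ fun a _ =>
      (BddMeas.sum s fun b _ => ((hb a).mul (hb b)).const_mul _).integrable _]
    refine Finset.sum_le_sum fun a ha => ?_
    rw [integral_finsetSum _ fun b _ => (((hb a).mul (hb b)).const_mul _).integrable _,
      Finset.sum_eq_single_of_mem a ha fun b _ hba => by
        rw [integral_const_mul, integral_coord_mul_coord i (Ne.symm hba), mul_zero],
      integral_const_mul, ← pow_two]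
    -- The coordinates are orthogonal but not normalised; a norm of at most one is all that is
    -- needed, and it may vanish.
    refine mul_le_of_le_one_right (sq_nonneg _) ?_
    calc ∫ ω, (ω a).coord i * (ω a).coord i ∂(initialLaw p)
        ≤ ∫ _ : Env d, (1 : ℝ) ∂(initialLaw p) := by
          refine integral_mono (((hb a).mul (hb a)).integrable _) (integrable_const _) fun ω => ?_
          have := Arrow.abs_coord_le i (ω a)
          rw [← pow_two]
          exact (sq_le_one_iff_abs_le_one _).2 this
      _ = 1 := by simp
  have h3 : 0 ≤ ∫ ω, (f ω - S ω) ^ 2 ∂(initialLaw p) := integral_nonneg fun ω => sq_nonneg _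
  have e3 : ∀ ω, (f ω - S ω) ^ 2 = (f ω ^ 2 - 2 * (S ω * f ω)) + S ω ^ 2 := fun ω => by ring
  have hSf := (hSb.mul hf).const_mul 2
  simp only [e3] at h3
  rw [integral_add ((hf.sq.sub hSf).integrable _) (hSb.sq.integrable _),
    integral_sub (hf.sq.integrable _) (hSf.integrable _), integral_const_mul, h1] at h3
  linarith

theorem summable_sq_integral_coord (i : Fin d) {f : Env d → ℝ} (hf : BddMeas f)
    {e : (Fin d → ℤ) → Site d} (he : Function.Injective e) :
    Summable fun x => (∫ ω, (ω (e x)).coord i * f ω ∂(initialLaw p)) ^ 2 :=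
  (summable_of_sum_le (fun _ => sq_nonneg _) (sum_sq_integral_coord_le (p := p) i hf)).comp_injective
    he

theorem tsum_sq_integral_coord_le (i : Fin d) {f : Env d → ℝ} (hf : BddMeas f)
    {e : (Fin d → ℤ) → Site d} (he : Function.Injective e) :
    ∑' x, (∫ ω, (ω (e x)).coord i * f ω ∂(initialLaw p)) ^ 2 ≤ ∫ ω, f ω ^ 2 ∂(initialLaw p) := by
  refine (summable_sq_integral_coord i hf he).tsum_le_of_sum_le fun s => ?_
  have := sum_sq_integral_coord_le (p := p) i hf (s.map ⟨e, he⟩)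
  simpa using this

/-- In dimension at least three, the correlation of a function with the arrow at the origin is
controlled by the gradient of the function. -/
theorem sq_integral_coord_zero_le (hd : 3 ≤ d) (i : Fin d) {u : Env d → ℝ} (hu : BddMeas u) :
    (∫ ω, (ω (some 0)).coord i * u ω ∂(initialLaw p)) ^ 2 ≤
      150 * ∑ e : Arrow d, ∫ ω, (u (shift e ω) - u ω) ^ 2 ∂(initialLaw p) := by
  have hb := bddMeas_coord_site (d := d) i
  refine (hardy_inequality hd (g := fun x => ∫ ω, (ω (some x)).coord i * u ω ∂(initialLaw p))
    (summable_sq_integral_coord i hu (Option.some_injective _))).trans ?_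
  refine mul_le_mul_of_nonneg_left (Finset.sum_le_sum fun e _ => ?_) (by norm_num)
  have hs := measurePreserving_shift (p := p) e
  have hus := hu.comp hs.measurable
  -- Invariance under `shift e` moves the translation from the site to `u`, so the gradient of the
  -- correlations consists of correlations with `u - u ∘ shift e`.
  have h1 : ∀ x, (∫ ω, (ω (some (x + e.vec))).coord i * u ω ∂(initialLaw p)) -
      ∫ ω, (ω (some x)).coord i * u ω ∂(initialLaw p) =
      ∫ ω, (ω (some (x + e.vec))).coord i * (u ω - u (shift e ω)) ∂(initialLaw p) := fun x => by
    rw [← integral_comp_measurePreserving hs ((hb (some x)).mul hu),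
      ← integral_sub (((hb _).mul hu).integrable _)
        ((((hb (some x)).mul hu).comp hs.measurable).integrable _)]
    refine integral_congr_ae (ae_of_all _ fun ω => ?_)
    simp only [shift]
    ring
  simp only [h1]
  refine (tsum_sq_integral_coord_le i (hu.sub hus)
    ((Option.some_injective _).comp (add_left_injective e.vec))).trans (le_of_eq ?_)
  exact integral_congr_ae (ae_of_all _ fun ω => by ring)

/-- A swap alone is not a move. The difference `u - u ∘ swap` is routed through `u ∘ shift e`, a
neighbour of both; invariance under the involution `swap` identifies the second leg with the move
that swaps and then steps. -/
theorem sq_integral_coord_sub_le (i : Fin d) {u : Env d → ℝ} (hu : BddMeas u) (e : Arrow d) :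
    ((∫ ω, (ω none).coord i * u ω ∂(initialLaw p)) -
        ∫ ω, (ω (some 0)).coord i * u ω ∂(initialLaw p)) ^ 2 ≤
      2 * ((∫ ω, (u (shift e ω) - u ω) ^ 2 ∂(initialLaw p)) +
        ∫ ω, (u (shift e (swap ω)) - u ω) ^ 2 ∂(initialLaw p)) := by
  have hb := bddMeas_coord_site (d := d) i
  have hσ := measurePreserving_swap (p := p)
  have hs := measurePreserving_shift (p := p) e
  have huσ := hu.comp hσ.measurable
  have hus := hu.comp hs.measurable
  have h1 : (∫ ω, (ω none).coord i * u ω ∂(initialLaw p)) -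
        ∫ ω, (ω (some 0)).coord i * u ω ∂(initialLaw p) =
      ∫ ω, (ω none).coord i * (u ω - u (swap ω)) ∂(initialLaw p) := by
    rw [← integral_comp_measurePreserving hσ ((hb (some 0)).mul hu),
      ← integral_sub (((hb _).mul hu).integrable _)
        ((((hb (some 0)).mul hu).comp hσ.measurable).integrable _)]
    refine integral_congr_ae (ae_of_all _ fun ω => ?_)
    simp only [swap, if_true]
    ring
  have h2 : ∫ ω, (u (shift e (swap ω)) - u ω) ^ 2 ∂(initialLaw p) =
      ∫ ω, (u (shift e ω) - u (swap ω)) ^ 2 ∂(initialLaw p) := by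
    rw [← integral_comp_measurePreserving hσ ((hus.comp hσ.measurable).sub hu).sq]
    simp only [swap_swap]
  rw [h1, h2, ← integral_add ((hus.sub hu).sq.integrable _) ((hus.sub huσ).sq.integrable _),
    ← integral_const_mul]
  refine (sq_integral_le ((hb none).mul (hu.sub huσ)) _).trans ?_
  refine integral_mono (((hb none).mul (hu.sub huσ)).sq.integrable _)
    ((((hus.sub hu).sq.add (hus.sub huσ).sq).const_mul 2).integrable _) fun ω => ?_
  have h3 := (sq_le_one_iff_abs_le_one _).2 (Arrow.abs_coord_le i (ω none))
  simp only [mul_pow]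
  nlinarith [mul_le_mul_of_nonneg_right h3 (sq_nonneg (u ω - u (swap ω))),
    sq_nonneg ((u (shift e ω) - u ω) + (u (shift e ω) - u (swap ω)))]

end Environment


/-! ### Moments of the embedded discrete-time walk -/

section Model

variable {d : ℕ} {p : stdSimplex ℝ (Fin d)}

/-- The `i`-th coordinate of the displacement in a jump. -/
def Move.coord (i : Fin d) (m : Move d) (ω : Env d) : ℝ := (m.displacement ω i : ℤ)

theorem Move.coord_some (i : Fin d) (e : Arrow d) (b c : Bool) (ω : Env d) :
    Move.coord i ⟨some e, b, c⟩ ω = e.coord i := rfl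

theorem Move.coord_none (i : Fin d) (b c : Bool) (ω : Env d) :
    Move.coord i ⟨none, b, c⟩ ω = (ω (if b then some 0 else none)).coord i := by
  cases b <;> rfl

theorem Move.bddMeas_coord (i : Fin d) (m : Move d) : BddMeas (Move.coord i m) := by
  obtain ⟨_ | e, b, c⟩ := m
  · rw [funext (Move.coord_none i b c)]
    exact bddMeas_coord_site i _
  · exact BddMeas.const (e.coord i)

theorem Model.moveLaw_real_singleton (M : Model) (ε : ℝ≥0) (m : Move d) :
    (M.moveLaw d ε).real {m} = M.rate ε m / M.totalRate d ε := by
  classical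
  have h : (M.moveLaw d ε) {m} = ((M.rate ε m / M.totalRate d ε : ℝ≥0) : ℝ≥0∞) := by
    rw [Model.moveLaw, Measure.finsetSum_apply, Finset.sum_eq_single m]
    · simp [Measure.smul_apply]
    · intro b _ hb
      simp [Measure.smul_apply, hb]
    · simp
  rw [measureReal_def, h]
  simp

theorem Model.rate_some (M : Model) (ε : ℝ≥0) (e : Arrow d) (b c : Bool) :
    M.rate ε ⟨some e, b, c⟩ = ε / (2 * (d : ℝ≥0)) * (1 / 4) := by
  cases M <;> rfl

/-- The drift of the walk is a combination of the arrow in the hand and the arrow at the origin. -/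
theorem Model.exists_drift_eq (hd : d ≠ 0) (M : Model) (ε : ℝ≥0) (i : Fin d) :
    ∃ α β : ℝ, |α| ≤ 1 ∧ |β| ≤ 1 ∧ ∀ ω : Env d, ∫ m, Move.coord i m ω ∂(M.moveLaw d ε) =
      α * (ω none).coord i + β * (ω (some 0)).coord i := by
  have := M.isProbabilityMeasure_moveLaw hd ε
  have hR : (M.totalRate d ε : ℝ) = 1 + ε := by rw [M.totalRate_eq hd]; simp
  have hR1 : (0 : ℝ) < 1 + ε := by positivity
  have hε : (0 : ℝ) ≤ ε := ε.2
  have key : ∀ ω : Env d, ∫ m, Move.coord i m ω ∂(M.moveLaw d ε) =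
      ∑ b : Bool, ∑ c : Bool,
        (M.rate ε (⟨none, b, c⟩ : Move d) : ℝ) / (1 + ε) * Move.coord i ⟨none, b, c⟩ ω := fun ω => by
    rw [integral_move, sum_move]
    simp only [Model.moveLaw_real_singleton, hR, Model.rate_some, Move.coord_some, sum_arrow,
      Arrow.coord_neg]
    -- Steps in opposite directions have equal rates and cancel, so only the steps along the hand
    -- arrow remain.
    refine (congrArg₂ (· + ·) ?_ (Finset.sum_eq_zero fun j _ => by ring)).trans (add_zero _)
    simp
  simp only [key, Fintype.sum_bool, Move.coord_none]
  cases M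
  · refine ⟨1 / (1 + ε), 0, ?_, by simp, fun ω => by simp [Model.rate]⟩
    rw [abs_of_pos (by positivity), div_le_one hR1]
    linarith
  · refine ⟨1 / 2 / (1 + ε), 1 / 2 / (1 + ε), ?_, ?_, fun ω => by simp [Model.rate]; ring⟩ <;>
    · rw [abs_of_pos (by positivity), div_le_one hR1]
      linarith

/-- Only the elliptic moves without a final swap are kept. The prefactor is the probability of one
such move, and all the other terms of the energy are nonnegative. -/
theorem Model.sum_le_energy (hd : d ≠ 0) (M : Model) (ε : ℝ≥0) {u : Env d → ℝ} (hu : BddMeas u) :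
    ((ε : ℝ) / (2 * d) * (1 / 4) / (1 + ε)) *
      ∑ e : Arrow d, ((∫ ω, (u (shift e ω) - u ω) ^ 2 ∂(initialLaw p)) +
        ∫ ω, (u (shift e (swap ω)) - u ω) ^ 2 ∂(initialLaw p)) ≤
      energy (initialLaw p) (M.moveLaw d ε) Move.apply u := by
  have := M.isProbabilityMeasure_moveLaw hd ε
  have hR : (M.totalRate d ε : ℝ) = 1 + ε := by rw [M.totalRate_eq hd]; simp
  have hb : ∀ m : Move d, BddMeas fun ω => (u (m.apply ω) - u ω) ^ 2 := fun m =>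
    ((hu.comp (measurePreserving_apply (p := p) m).measurable).sub hu).sq
  have h1 : energy (initialLaw p) (M.moveLaw d ε) Move.apply u =
      ∑ m : Move d, (M.moveLaw d ε).real {m} *
        ∫ ω, (u (m.apply ω) - u ω) ^ 2 ∂(initialLaw p) := by
    simp only [energy, integral_move]
    rw [integral_finsetSum _ fun m _ => ((hb m).const_mul _).integrable _]
    simp only [integral_const_mul]
  have hpos : ∀ m : Move d, 0 ≤ (M.moveLaw d ε).real {m} *
      ∫ ω, (u (m.apply ω) - u ω) ^ 2 ∂(initialLaw p) := fun m =>
    mul_nonneg measureReal_nonneg (integral_nonneg fun ω => sq_nonneg _)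
  rw [h1, sum_move, Finset.mul_sum]
  refine le_add_of_nonneg_of_le (by positivity) (Finset.sum_le_sum fun e _ => ?_)
  have e1 : ∀ b c, (M.moveLaw d ε).real {(⟨some e, b, c⟩ : Move d)} =
      (ε : ℝ) / (2 * d) * (1 / 4) / (1 + ε) := fun b c => by
    rw [Model.moveLaw_real_singleton, Model.rate_some, hR]
    simp
  have h2 := hpos ⟨some e, true, true⟩
  have h3 := hpos ⟨some e, false, true⟩
  have h4 : (Move.apply (⟨some e, true, false⟩ : Move d)) = fun ω => shift e (swap ω) := rfl
  have h5 : (Move.apply (⟨some e, false, false⟩ : Move d)) = shift e := rfl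
  rw [e1 true false, e1 false false, h4, h5, mul_add]
  linarith

/-- The drift of the walk lies in the space `H₋₁`. -/
theorem Model.exists_sq_integral_drift_le (hd : 3 ≤ d) (M : Model) {ε : ℝ≥0} (hε : 0 < ε)
    (i : Fin d) :
    ∃ K : ℝ, 0 ≤ K ∧ ∀ u : Env d → ℝ, BddMeas u →
      (∫ ω, (∫ m, Move.coord i m ω ∂(M.moveLaw d ε)) * u ω ∂(initialLaw p)) ^ 2 ≤
        K * energy (initialLaw p) (M.moveLaw d ε) Move.apply u := by
  have hd0 : d ≠ 0 := by omega
  have hdr : (0 : ℝ) < d := by exact_mod_cast Nat.pos_of_ne_zero hd0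
  have hεr : (0 : ℝ) < ε := by exact_mod_cast hε
  obtain ⟨α, β, hα, hβ, hdrift⟩ := M.exists_drift_eq hd0 ε i
  set q : ℝ := (ε : ℝ) / (2 * d) * (1 / 4) / (1 + ε) with hq
  have hq0 : 0 < q := by positivity
  -- In units of `E / q`: `g0² ≤ 150` and `(gh - g0)² ≤ 2`, so `gh² ≤ 2 * (150 + 2) = 304`, and `2 *
  -- (304 + 150) = 908`.
  refine ⟨908 / q, by positivity, fun u hu => ?_⟩
  have hE := M.sum_le_energy (p := p) hd0 ε hu
  have hb := bddMeas_coord_site (d := d) i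
  have hg0 := sq_integral_coord_zero_le (p := p) hd i hu
  have hgs := sq_integral_coord_sub_le (p := p) i hu (i, 1)
  rw [← hq] at hE
  set E := energy (initialLaw p) (M.moveLaw d ε) Move.apply u
  set A : Arrow d → ℝ := fun e => ∫ ω, (u (shift e ω) - u ω) ^ 2 ∂(initialLaw p) with hA
  set B : Arrow d → ℝ := fun e => ∫ ω, (u (shift e (swap ω)) - u ω) ^ 2 ∂(initialLaw p) with hB
  have hA0 : ∀ e, 0 ≤ A e := fun e => integral_nonneg fun ω => sq_nonneg _
  have hB0 : ∀ e, 0 ≤ B e := fun e => integral_nonneg fun ω => sq_nonneg _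
  have hS : ∑ e, (A e + B e) ≤ E / q := by rw [le_div_iff₀ hq0]; linarith
  have h1 : ∑ e, A e ≤ E / q :=
    (Finset.sum_le_sum fun e _ => le_add_of_nonneg_right (hB0 e)).trans hS
  have h2 : A (i, 1) + B (i, 1) ≤ E / q :=
    (Finset.single_le_sum (f := fun e => A e + B e) (fun e _ => add_nonneg (hA0 e) (hB0 e))
      (Finset.mem_univ (i, 1))).trans hS
  set gh := ∫ ω, (ω none).coord i * u ω ∂(initialLaw p) with hgh
  set g0 := ∫ ω, (ω (some 0)).coord i * u ω ∂(initialLaw p) with hg0'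
  have h3 : ∫ ω, (∫ m, Move.coord i m ω ∂(M.moveLaw d ε)) * u ω ∂(initialLaw p) =
      α * gh + β * g0 := by
    simp only [hdrift, add_mul, mul_assoc]
    rw [integral_add ((((hb _).mul hu).const_mul _).integrable _)
      ((((hb _).mul hu).const_mul _).integrable _), integral_const_mul, integral_const_mul]
  have hα2 := (sq_le_one_iff_abs_le_one _).2 hα
  have hβ2 := (sq_le_one_iff_abs_le_one _).2 hβ
  have h4 : g0 ^ 2 ≤ 150 * (E / q) := hg0.trans (by linarith)
  have h5 : (gh - g0) ^ 2 ≤ 2 * (E / q) := hgs.trans (by linarith)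
  have h6 : gh ^ 2 ≤ 304 * (E / q) := by nlinarith [sq_nonneg (gh - g0 - g0)]
  rw [h3]
  calc (α * gh + β * g0) ^ 2 ≤ 2 * (α ^ 2 * gh ^ 2 + β ^ 2 * g0 ^ 2) := by
        nlinarith [sq_nonneg (α * gh - β * g0)]
    _ ≤ 2 * (1 * gh ^ 2 + 1 * g0 ^ 2) := by gcongr
    _ ≤ 908 / q * E := by
        rw [div_mul_eq_mul_div, mul_div_assoc]
        linarith

/-- The sum of the squares of the coordinates of the walk after `n` jumps. -/
noncomputable def walkNormSq (n : ℕ) (z : Env d × (ℕ → Move d)) : ℝ :=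
  ∑ i, walk Move.apply (Move.coord i) n z ^ 2

theorem bddMeas_walkNormSq (hT : ∀ m : Move d, Measurable m.apply) (n : ℕ) :
    BddMeas (walkNormSq (d := d) n) :=
  BddMeas.sum _ fun i _ => (bddMeas_walk hT (Move.bddMeas_coord i) n).sq

theorem Model.exists_integral_walkNormSq_bounds (hd : 3 ≤ d) (p : stdSimplex ℝ (Fin d)) (M : Model)
    {ε : ℝ≥0} (hε : 0 < ε) :
    ∃ c D : ℝ, 0 < c ∧ 0 < D ∧
      (∀ n : ℕ, ∫ z, walkNormSq n z ∂(pathLaw (initialLaw p) (M.moveLaw d ε)) ≤ D * n) ∧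
      ∃ n₁ : ℕ, ∀ n ≥ n₁,
        c * n ≤ ∫ z, walkNormSq n z ∂(pathLaw (initialLaw p) (M.moveLaw d ε)) := by
  have hd0 : d ≠ 0 := by omega
  have := M.isProbabilityMeasure_moveLaw hd0 ε
  have hT : ∀ m : Move d, MeasurePreserving m.apply (initialLaw p) (initialLaw p) :=
    measurePreserving_apply
  have hup : ∀ i : Fin d, ∃ D : ℝ, ∀ n : ℕ,
      ∫ z, walk Move.apply (Move.coord i) n z ^ 2 ∂(pathLaw (initialLaw p) (M.moveLaw d ε)) ≤
        D * n := fun i => by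
    obtain ⟨K, hK0, hK⟩ := M.exists_sq_integral_drift_le (p := p) hd hε i
    exact ⟨_, integral_walk_sq_le hT (Move.bddMeas_coord i) hK0 hK⟩
  choose D hD using hup
  have hsum : ∀ n : ℕ, ∫ z, walkNormSq n z ∂(pathLaw (initialLaw p) (M.moveLaw d ε)) =
      ∑ i, ∫ z, walk Move.apply (Move.coord i) n z ^ 2
        ∂(pathLaw (initialLaw p) (M.moveLaw d ε)) := fun n =>
    integral_finsetSum _ fun i _ =>
      (bddMeas_walk (fun m => (hT m).measurable) (Move.bddMeas_coord i) n).sq.integrable _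
  let i₀ : Fin d := ⟨0, by omega⟩
  -- An elliptic step along `e_{i₀}` has positive probability because `ε > 0`, and its displacement
  -- does not depend on the environment.
  have hm₀ : 0 < (M.moveLaw d ε).real {(⟨some (i₀, 1), false, false⟩ : Move d)} := by
    rw [Model.moveLaw_real_singleton, Model.rate_some, M.totalRate_eq hd0]
    have : (0 : ℝ) < d := by exact_mod_cast Nat.pos_of_ne_zero hd0
    have hεr : (0 : ℝ) < ε := by exact_mod_cast hε
    push_cast
    positivity
  obtain ⟨c, hc, n₁, hn₁⟩ := exists_le_integral_walk_sq hT (Move.bddMeas_coord i₀) (hD i₀) hm₀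
    (c := 1) one_ne_zero (fun ω => by simp [Move.coord_some, Arrow.coord, Arrow.vec])
  refine ⟨c, max (∑ i, D i) 1, hc, by positivity, fun n => ?_, n₁, fun n hn => ?_⟩
  · rw [hsum]
    calc _ ≤ ∑ i, D i * n := Finset.sum_le_sum fun i _ => hD i n
      _ = (∑ i, D i) * n := by rw [Finset.sum_mul]
      _ ≤ _ := by gcongr; exact le_max_left _ _
  · rw [hsum]
    exact (hn₁ n hn).trans (Finset.single_le_sum (f := fun i => ∫ z,
      walk Move.apply (Move.coord i) n z ^ 2 ∂(pathLaw (initialLaw p) (M.moveLaw d ε)))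
      (fun i _ => integral_nonneg fun z => sq_nonneg _) (Finset.mem_univ i₀))

/-! ### The walk and the embedded chain -/

theorem chain_eq (w : Sample d) (n : ℕ) :
    (chain w n).1 = pathState Move.apply n (w.1, fun k => (w.2 k).2) ∧
      ∀ i, ((chain w n).2 i : ℝ) =
        walk Move.apply (Move.coord i) n (w.1, fun k => (w.2 k).2) := by
  induction n with
  | zero => exact ⟨rfl, fun i => by simp [chain]⟩
  | succ n ih =>
    refine ⟨?_, fun i => ?_⟩
    · rw [pathState_succ, ← ih.1]; rfl
    · rw [walk_succ, ← ih.1, ← ih.2]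
      simp [chain, Move.coord]

end Model


/-! ### The number of jumps -/

section Renewal

variable {r : ℝ}

/-- Negative `θ` is allowed on purpose: `θ = 1/t` will bound the number of jumps from above, `θ =
-r/2` from below. -/
theorem lintegral_exp_expMeasure (hr : 0 < r) {θ : ℝ} (hθ : 0 < r + θ) :
    ∫⁻ x, ENNReal.ofReal (Real.exp (-(θ * x))) ∂(expMeasure r) = ENNReal.ofReal (r / (r + θ)) := by
  have hm : ∀ r : ℝ, Measurable (exponentialPDF r) := fun r =>
    (measurable_exponentialPDFReal r).ennreal_ofReal
  have h1 : expMeasure r = volume.withDensity (exponentialPDF r) := rfl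
  rw [h1, lintegral_withDensity_eq_lintegral_mul _ (hm r) (by fun_prop)]
  have h2 : ∀ x, (exponentialPDF r * fun x => ENNReal.ofReal (Real.exp (-(θ * x)))) x =
      ENNReal.ofReal (r / (r + θ)) * exponentialPDF (r + θ) x := fun x => by
    rw [Pi.mul_apply]
    rcases lt_or_ge x 0 with hx | hx
    · simp [exponentialPDF_of_neg hx]
    · rw [exponentialPDF_of_nonneg hx, exponentialPDF_of_nonneg hx,
        ← ENNReal.ofReal_mul (by positivity), ← ENNReal.ofReal_mul (by positivity), mul_assoc,
        ← Real.exp_add]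
      congr 1
      rw [show -(r * x) + -(θ * x) = -((r + θ) * x) by ring]
      field_simp
  simp only [h2]
  rw [lintegral_const_mul _ (hm _), lintegral_exponentialPDF_eq_one hθ, mul_one]

theorem expMeasure_Iio_zero (r : ℝ) : expMeasure r (Set.Iio 0) = 0 := by
  have h1 : expMeasure r = volume.withDensity (exponentialPDF r) := rfl
  rw [h1, withDensity_apply _ measurableSet_Iio, lintegral_exponentialPDF_of_nonpos le_rfl]

/-- The law of the waiting times. -/
noncomputable abbrev timeLaw (r : ℝ) : Measure (ℕ → ℝ) := Measure.infinitePi fun _ : ℕ => expMeasure r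

/-- The number of jumps up to time `t`, given the waiting times. -/
noncomputable def jumpCount (t : ℝ) (s : ℕ → ℝ) : ℕ :=
  {n : ℕ | ∑ k ∈ Finset.range (n + 1), s k ≤ t}.ncard

theorem measurableSet_sum_le (n : ℕ) (t : ℝ) :
    MeasurableSet {s : ℕ → ℝ | ∑ k ∈ Finset.range n, s k ≤ t} :=
  measurableSet_le (by fun_prop) measurable_const

theorem encard_eq_tsum (t : ℝ) (s : ℕ → ℝ) :
    (({n : ℕ | ∑ k ∈ Finset.range (n + 1), s k ≤ t}.encard : ℕ∞) : ℝ≥0∞) =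
      ∑' n : ℕ, {s : ℕ → ℝ | ∑ k ∈ Finset.range (n + 1), s k ≤ t}.indicator 1 s := by
  rw [← ENNReal.tsum_set_one, tsum_subtype _ (fun _ : ℕ => (1 : ℝ≥0∞))]
  rfl

/-- Measurability of the count comes from this series. For infinitely many jumps both sides take the
default value `0`, of `ncard` and of `toReal`. -/
theorem jumpCount_eq_toReal (t : ℝ) (s : ℕ → ℝ) :
    (jumpCount t s : ℝ) = ENNReal.toReal
      (∑' n : ℕ, {s : ℕ → ℝ | ∑ k ∈ Finset.range (n + 1), s k ≤ t}.indicator 1 s) := by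
  rw [← encard_eq_tsum, jumpCount]
  rcases Set.finite_or_infinite {n : ℕ | ∑ k ∈ Finset.range (n + 1), s k ≤ t} with h | h
  · rw [← h.cast_ncard_eq]; simp
  · rw [h.ncard, h.encard_eq]; simp

theorem measurable_tsum_indicator (t : ℝ) : Measurable fun s : ℕ → ℝ =>
    ∑' n : ℕ, {s : ℕ → ℝ | ∑ k ∈ Finset.range (n + 1), s k ≤ t}.indicator (1 : (ℕ → ℝ) → ℝ≥0∞) s :=
  Measurable.tsum fun n => measurable_one.indicator (measurableSet_sum_le (n + 1) t)

theorem measurable_jumpCount (t : ℝ) : Measurable (jumpCount t) := by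
  have : jumpCount t = fun s => ⌊ENNReal.toReal
      (∑' n : ℕ, {s : ℕ → ℝ | ∑ k ∈ Finset.range (n + 1), s k ≤ t}.indicator 1 s)⌋₊ := by
    funext s
    rw [← jumpCount_eq_toReal, Nat.floor_natCast]
  rw [this]
  exact Nat.measurable_floor.comp (measurable_tsum_indicator t).ennreal_toReal

theorem jumpCount_le_tsum (t : ℝ) (s : ℕ → ℝ) : (jumpCount t s : ℝ≥0∞) ≤
    ∑' n : ℕ, {s : ℕ → ℝ | ∑ k ∈ Finset.range (n + 1), s k ≤ t}.indicator 1 s := by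
  have h : (jumpCount t s : ℝ≥0∞) = ENNReal.ofReal (jumpCount t s : ℝ) := by simp
  rw [h, jumpCount_eq_toReal]
  exact ENNReal.ofReal_toReal_le

/-- Finiteness cannot be dropped, as `ncard` of an infinite set is `0`. -/
theorem le_jumpCount {t : ℝ} {s : ℕ → ℝ} (hs : ∀ k, 0 ≤ s k)
    (hfin : ∑' n : ℕ, {s : ℕ → ℝ | ∑ k ∈ Finset.range (n + 1), s k ≤ t}.indicator
      (1 : (ℕ → ℝ) → ℝ≥0∞) s ≠ ∞) {n : ℕ} (hn : ∑ k ∈ Finset.range n, s k ≤ t) :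
    n ≤ jumpCount t s := by
  rw [← encard_eq_tsum] at hfin
  have hf : {n : ℕ | ∑ k ∈ Finset.range (n + 1), s k ≤ t}.Finite := by
    by_contra h
    rw [Set.Infinite.encard_eq h] at hfin
    simp at hfin
  have hsub : (Finset.range n : Set ℕ) ⊆ {n : ℕ | ∑ k ∈ Finset.range (n + 1), s k ≤ t} :=
    fun j hj => by
      have hj' : j + 1 ≤ n := by simpa using hj
      exact (Finset.sum_le_sum_of_subset_of_nonneg (Finset.range_subset_range.2 hj')
        fun k _ _ => hs k).trans hn
  simpa [jumpCount] using Set.ncard_le_ncard hsub hf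

variable [Fact (0 < r)]

instance : IsProbabilityMeasure (expMeasure r) := isProbabilityMeasure_expMeasure Fact.out

theorem lintegral_exp_sum {θ : ℝ} (hθ : 0 < r + θ) (n : ℕ) :
    ∫⁻ s, ENNReal.ofReal (Real.exp (-(θ * ∑ k ∈ Finset.range n, s k))) ∂(timeLaw r) =
      ENNReal.ofReal (r / (r + θ)) ^ n := by
  have hg : Measurable fun x : ℝ => ENNReal.ofReal (Real.exp (-(θ * x))) := by fun_prop
  have h1 : ∀ s : ℕ → ℝ, ENNReal.ofReal (Real.exp (-(θ * ∑ k ∈ Finset.range n, s k))) =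
      ∏ k ∈ Finset.range n, ENNReal.ofReal (Real.exp (-(θ * s k))) := fun s => by
    rw [← ENNReal.ofReal_prod_of_nonneg fun k _ => (Real.exp_pos _).le, ← Real.exp_sum,
      Finset.mul_sum, Finset.sum_neg_distrib]
  simp only [h1]
  rw [lintegral_prod_eq_prod_lintegral_of_indepFun (Finset.range n)
    (fun k (s : ℕ → ℝ) => ENNReal.ofReal (Real.exp (-(θ * s k))))
    (iIndepFun_infinitePi (P := fun _ : ℕ => expMeasure r) (X := fun k x => _) fun _ => hg)
    fun k => hg.comp (measurable_pi_apply k)]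
  rw [Finset.prod_congr rfl fun k _ => (?_ : _ = ENNReal.ofReal (r / (r + θ)))]
  · simp
  · rw [← lintegral_exp_expMeasure (r := r) Fact.out hθ,
      ← (measurePreserving_eval_infinitePi (fun _ : ℕ => expMeasure r) k).lintegral_comp hg]

/-- Exponential Markov inequality for the time of the `n`-th jump. -/
theorem timeLaw_sum_le {θ : ℝ} (hθ : 0 < r + θ) (n : ℕ) {t : ℝ} {A : Set (ℕ → ℝ)}
    (hA : ∀ s ∈ A, θ * ∑ k ∈ Finset.range n, s k ≤ θ * t) :
    timeLaw r A ≤ ENNReal.ofReal (Real.exp (θ * t)) * ENNReal.ofReal (r / (r + θ)) ^ n := by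
  rw [← lintegral_exp_sum hθ, ← lintegral_const_mul _ (by fun_prop)]
  calc timeLaw r A ≤ timeLaw r {s : ℕ → ℝ | 1 ≤ ENNReal.ofReal (Real.exp (θ * t)) *
        ENNReal.ofReal (Real.exp (-(θ * ∑ k ∈ Finset.range n, s k)))} := by
        refine measure_mono fun s hs => ?_
        show 1 ≤ ENNReal.ofReal (Real.exp (θ * t)) *
          ENNReal.ofReal (Real.exp (-(θ * ∑ k ∈ Finset.range n, s k)))
        rw [← ENNReal.ofReal_mul (Real.exp_pos _).le, ← Real.exp_add, ENNReal.one_le_ofReal,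
          Real.one_le_exp_iff]
        linarith [hA s hs]
    _ ≤ _ := by
        have := mul_meas_ge_le_lintegral (μ := timeLaw r) (f := fun s =>
          ENNReal.ofReal (Real.exp (θ * t)) *
            ENNReal.ofReal (Real.exp (-(θ * ∑ k ∈ Finset.range n, s k)))) (by fun_prop) 1
        simpa using this

/-- The Markov inequality with `θ = 1/t` bounds the probability of the `n`-th term by `e * q ^ (n +
1)`, and the geometric series sums to `e * r * t`. -/
theorem lintegral_tsum_indicator_le {t : ℝ} (ht : 0 < t) :
    ∫⁻ s, ∑' n : ℕ, {s : ℕ → ℝ | ∑ k ∈ Finset.range (n + 1), s k ≤ t}.indicator 1 s ∂(timeLaw r) ≤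
      ENNReal.ofReal (Real.exp 1 * r * t) := by
  have hr : 0 < r := Fact.out
  rw [lintegral_tsum fun n =>
    (measurable_one.indicator (measurableSet_sum_le (n + 1) t)).aemeasurable]
  simp only [lintegral_indicator_one (measurableSet_sum_le _ t)]
  set q : ℝ := r / (r + t⁻¹) with hq
  have hq0 : 0 < q := by positivity
  have hq1 : q < 1 := by
    rw [hq, div_lt_one (by positivity)]
    exact lt_add_of_pos_right _ (by positivity)
  have h1 : ∀ n : ℕ, timeLaw r {s : ℕ → ℝ | ∑ k ∈ Finset.range (n + 1), s k ≤ t} ≤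
      ENNReal.ofReal (Real.exp 1 * q * q ^ n) := fun n => by
    refine (timeLaw_sum_le (θ := t⁻¹) (t := t) (by positivity) (n + 1) fun s hs => ?_).trans
      (le_of_eq ?_)
    · exact mul_le_mul_of_nonneg_left hs (by positivity)
    · rw [inv_mul_cancel₀ ht.ne', ← ENNReal.ofReal_pow hq0.le,
        ← ENNReal.ofReal_mul (Real.exp_pos _).le]
      congr 1
      ring
  refine (ENNReal.tsum_le_tsum h1).trans (le_of_eq ?_)
  have hs := (summable_geometric_of_lt_one hq0.le hq1).mul_left (Real.exp 1 * q)
  rw [← ENNReal.ofReal_tsum_of_nonneg (fun n => by positivity) hs, tsum_mul_left,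
    tsum_geometric_of_lt_one hq0.le hq1]
  congr 1
  have : 1 - q = q / (r * t) := by rw [hq]; field_simp; ring
  rw [this]
  field_simp

theorem lintegral_jumpCount_le {t : ℝ} (ht : 0 < t) :
    ∫⁻ s, (jumpCount t s : ℝ≥0∞) ∂(timeLaw r) ≤ ENNReal.ofReal (Real.exp 1 * r * t) :=
  (lintegral_mono fun s => jumpCount_le_tsum t s).trans (lintegral_tsum_indicator_le ht)

theorem ae_le_jumpCount {t : ℝ} (ht : 0 < t) (n : ℕ) :
    ∀ᵐ s ∂(timeLaw r), ∑ k ∈ Finset.range n, s k ≤ t → n ≤ jumpCount t s := by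
  have h1 : ∀ᵐ s ∂(timeLaw r), ∀ k, 0 ≤ s k := by
    refine ae_all_iff.2 fun k => ?_
    have h := measurePreserving_eval_infinitePi (fun _ : ℕ => expMeasure r) k
    refine h.quasiMeasurePreserving.ae (p := fun x => 0 ≤ x) ?_
    rw [ae_iff]
    simpa [← Set.Iio_def] using expMeasure_Iio_zero r
  have h2 := ae_lt_top (measurable_tsum_indicator t)
    ((lintegral_tsum_indicator_le (r := r) ht).trans_lt ENNReal.ofReal_lt_top).ne
  filter_upwards [h1, h2] with s hs hfin hn
  exact le_jumpCount hs hfin.ne hn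

/-- With `θ = -r/2` each waiting time contributes a factor `2 ≤ e`, so the complement has
probability at most `exp (n - r t / 2) ≤ 1/e`. -/
theorem half_le_timeLaw {t : ℝ} {n : ℕ} (hn : (n : ℝ) + 1 ≤ r * t / 2) :
    ENNReal.ofReal (1 / 2) ≤ timeLaw r {s : ℕ → ℝ | ∑ k ∈ Finset.range n, s k ≤ t} := by
  have hr : 0 < r := Fact.out
  have hm := measurableSet_sum_le n t
  have h1 : timeLaw r {s : ℕ → ℝ | ∑ k ∈ Finset.range n, s k ≤ t}ᶜ ≤ ENNReal.ofReal (1 / 2) := by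
    refine (timeLaw_sum_le (θ := -(r / 2)) (t := t) (by linarith) n fun s hs => ?_).trans ?_
    · have hs' : ¬ (∑ k ∈ Finset.range n, s k ≤ t) := hs
      nlinarith [not_le.1 hs']
    · rw [show r / (r + -(r / 2)) = 2 by field_simp; norm_num, ← ENNReal.ofReal_pow (by norm_num),
        ← ENNReal.ofReal_mul (Real.exp_pos _).le]
      refine ENNReal.ofReal_le_ofReal ?_
      have h2 : (2 : ℝ) ≤ Real.exp 1 := by linarith [Real.add_one_le_exp (1 : ℝ)]
      calc Real.exp (-(r / 2) * t) * 2 ^ n ≤ Real.exp (-(r / 2) * t) * Real.exp 1 ^ n := by gcongr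
        _ = Real.exp (-(r / 2) * t + n) := by rw [← Real.exp_nat_mul, ← Real.exp_add, mul_one]
        _ ≤ Real.exp (-1) := Real.exp_le_exp.2 (by linarith)
        _ ≤ 1 / 2 := by
          rw [Real.exp_neg, one_div]
          exact inv_anti₀ (by norm_num) h2
  have h3 := prob_add_prob_compl (μ := timeLaw r) hm
  by_contra hcon
  push Not at hcon
  have h4 := ENNReal.add_lt_add_of_lt_of_le (ne_top_of_le_ne_top ENNReal.ofReal_ne_top h1) hcon h1
  rw [h3, ← ENNReal.ofReal_add (by norm_num) (by norm_num)] at h4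
  norm_num at h4

end Renewal


/-! ### The mean-square displacement -/

section Displacement

variable {d : ℕ}

/-- The waiting times can be drawn first, and then the initial environment and the jumps. -/
theorem Model.measurePreserving_sample (p : stdSimplex ℝ (Fin d)) (M : Model) (ε : ℝ≥0)
    [IsProbabilityMeasure (M.moveLaw d ε)]
    [IsProbabilityMeasure (expMeasure (M.totalRate d ε : ℝ))] :
    MeasurePreserving
      (fun q : (ℕ → ℝ) × (Env d × (ℕ → Move d)) => ((q.2.1, fun k => (q.1 k, q.2.2 k)) : Sample d))
      ((timeLaw (M.totalRate d ε)).prod (pathLaw (initialLaw p) (M.moveLaw d ε))) (M.law ε p) := by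
  have h1 := Measure.measurePreserving_swap (μ := timeLaw (M.totalRate d ε))
    (ν := pathLaw (initialLaw p) (M.moveLaw d ε))
  have h2 := measurePreserving_prodAssoc (initialLaw p)
    (Measure.infinitePi fun _ : ℕ => M.moveLaw d ε) (timeLaw (M.totalRate d ε))
  have h3 := (MeasurePreserving.id (initialLaw p)).prod
    (Measure.measurePreserving_swap (μ := Measure.infinitePi fun _ : ℕ => M.moveLaw d ε)
      (ν := timeLaw (M.totalRate d ε)))
  have h4 := (MeasurePreserving.id (initialLaw p)).prod
    (measurePreserving_infinitePi_zip (ι := ℕ) (expMeasure (M.totalRate d ε : ℝ)) (M.moveLaw d ε))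
  exact h4.comp (h3.comp (h2.comp h1))

theorem sum_position_sq (w : Sample d) (t : ℝ) :
    ∑ i, (position w t i : ℝ) ^ 2 =
      walkNormSq (jumpCount t fun k => (w.2 k).1) (w.1, fun k => (w.2 k).2) := by
  have : numJumps w t = jumpCount t fun k => (w.2 k).1 := rfl
  simp only [position, walkNormSq, this, (chain_eq w _).2]

theorem measurable_walkNormSq_comp {α : Type*} [MeasurableSpace α]
    (hT : ∀ m : Move d, Measurable m.apply) {N : α → ℕ} {f : α → Env d × (ℕ → Move d)}
    (hN : Measurable N) (hf : Measurable f) :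
    Measurable fun a => ENNReal.ofReal (walkNormSq (N a) (f a)) := by
  have hW : Measurable fun q : (Env d × (ℕ → Move d)) × ℕ => walkNormSq q.2 q.1 :=
    measurable_from_prod_countable_left fun n => (bddMeas_walkNormSq hT n).meas
  exact (hW.comp (hf.prodMk hN)).ennreal_ofReal

/-- The number of jumps depends on the waiting times alone, so by Tonelli the walk can be averaged
with that number held fixed. -/
theorem meanSquareDisplacement_eq (hd : d ≠ 0) (p : stdSimplex ℝ (Fin d)) (M : Model) (ε : ℝ≥0)
    (t : ℝ) :
    meanSquareDisplacement M ε p t = ∫⁻ s, ENNReal.ofReal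
      (∫ z, walkNormSq (jumpCount t s) z ∂(pathLaw (initialLaw p) (M.moveLaw d ε)))
        ∂(timeLaw (M.totalRate d ε)) := by
  have := M.isProbabilityMeasure_moveLaw hd ε
  have : IsProbabilityMeasure (expMeasure (M.totalRate d ε : ℝ)) := by
    apply isProbabilityMeasure_expMeasure
    rw [M.totalRate_eq hd]; positivity
  have hT : ∀ m : Move d, Measurable m.apply := fun m =>
    (measurePreserving_apply (p := p) m).measurable
  have hF : Measurable fun w : Sample d => ENNReal.ofReal (∑ i, (position w t i : ℝ) ^ 2) := by
    simp only [sum_position_sq]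
    exact measurable_walkNormSq_comp hT ((measurable_jumpCount t).comp (by fun_prop)) (by fun_prop)
  have hG := measurable_walkNormSq_comp hT (α := (ℕ → ℝ) × (Env d × (ℕ → Move d)))
    ((measurable_jumpCount t).comp measurable_fst) measurable_snd
  have hmp := M.measurePreserving_sample p ε
  rw [meanSquareDisplacement, ← hmp.lintegral_comp hF]
  simp only [sum_position_sq]
  refine (lintegral_prod _ hG.aemeasurable).trans ?_
  refine lintegral_congr fun s => ?_
  simp only [Function.comp_apply]
  rw [ofReal_integral_eq_lintegral_ofReal ((bddMeas_walkNormSq hT _).integrable _)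
    (ae_of_all _ fun z => Finset.sum_nonneg fun i _ => sq_nonneg _)]

/-- Linear bounds for the mean-square displacement. -/
theorem exists_meanSquareDisplacement_bounds (hd : 3 ≤ d) (p : stdSimplex ℝ (Fin d)) (M : Model)
    {ε : ℝ≥0} (hε : 0 < ε) :
    ∃ C D t₀ : ℝ, 0 < C ∧ 0 < D ∧ 0 < t₀ ∧
      (∀ t, 0 < t → meanSquareDisplacement M ε p t ≤ ENNReal.ofReal (D * t)) ∧
      ∀ t, t₀ ≤ t → ENNReal.ofReal (C * t) ≤ meanSquareDisplacement M ε p t := by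
  have hd0 : d ≠ 0 := by omega
  obtain ⟨c, D, hc, hD, hup, n₁, hlow⟩ := M.exists_integral_walkNormSq_bounds hd p hε
  have := M.isProbabilityMeasure_moveLaw hd0 ε
  have hr : (0 : ℝ) < M.totalRate d ε := by rw [M.totalRate_eq hd0]; positivity
  have : Fact ((0 : ℝ) < M.totalRate d ε) := ⟨hr⟩
  have hE := meanSquareDisplacement_eq hd0 p M ε
  set r : ℝ := (M.totalRate d ε : ℝ)
  set A : ℕ → ℝ := fun n => ∫ z, walkNormSq n z ∂(pathLaw (initialLaw p) (M.moveLaw d ε)) with hA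
  -- For the lower bound, at least `n = ⌊r t / 4⌋` jumps occur with probability at least `1/2`. The
  -- third witness ensures `n ≥ n₁` and `n ≥ r t / 8`, hence the factor `1/16`.
  refine ⟨c * r / 16, D * (Real.exp 1 * r), (8 + 4 * (n₁ + 1)) / r, by positivity, by positivity,
    by positivity, fun t ht => ?_, fun t ht => ?_⟩
  · rw [hE]
    calc ∫⁻ s, ENNReal.ofReal (A (jumpCount t s)) ∂(timeLaw r)
        ≤ ∫⁻ s, ENNReal.ofReal D * (jumpCount t s : ℝ≥0∞) ∂(timeLaw r) := by
          refine lintegral_mono fun s => ?_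
          rw [← ENNReal.ofReal_natCast, ← ENNReal.ofReal_mul hD.le]
          exact ENNReal.ofReal_le_ofReal (hup _)
      _ ≤ ENNReal.ofReal D * ENNReal.ofReal (Real.exp 1 * r * t) := by
          have hm : Measurable fun s => (jumpCount t s : ℝ≥0∞) :=
            (measurable_of_countable (fun n : ℕ => (n : ℝ≥0∞))).comp (measurable_jumpCount t)
          rw [lintegral_const_mul _ hm]
          gcongr
          exact lintegral_jumpCount_le ht
      _ = _ := by rw [← ENNReal.ofReal_mul hD.le]; congr 1; ring
  · have hrt : 8 + 4 * ((n₁ : ℝ) + 1) ≤ r * t := by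
      rw [div_le_iff₀ hr] at ht
      linarith
    have ht0 : 0 < t := lt_of_lt_of_le (by positivity) ht
    set n := ⌊r * t / 4⌋₊ with hn
    have hn1 : (n : ℝ) ≤ r * t / 4 := Nat.floor_le (by positivity)
    have hn2 : r * t / 4 < n + 1 := Nat.lt_floor_add_one _
    have hn₁ : n₁ ≤ n := by
      have : (n₁ : ℝ) < n + 1 := by linarith
      have : n₁ < n + 1 := by exact_mod_cast this
      omega
    rw [hE]
    calc ENNReal.ofReal (c * r / 16 * t) ≤ ENNReal.ofReal (c * n) * ENNReal.ofReal (1 / 2) := by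
          rw [← ENNReal.ofReal_mul (by positivity)]
          refine ENNReal.ofReal_le_ofReal ?_
          have : r * t / 8 ≤ n := by linarith
          nlinarith
      _ ≤ ENNReal.ofReal (c * n) * timeLaw r {s : ℕ → ℝ | ∑ k ∈ Finset.range n, s k ≤ t} := by
          gcongr
          exact half_le_timeLaw (by linarith)
      _ = ∫⁻ s, {s : ℕ → ℝ | ∑ k ∈ Finset.range n, s k ≤ t}.indicator
            (fun _ => ENNReal.ofReal (c * n)) s ∂(timeLaw r) :=
          (lintegral_indicator_const (measurableSet_sum_le n t) _).symm
      _ ≤ _ := by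
          refine lintegral_mono_ae ?_
          filter_upwards [ae_le_jumpCount (r := r) ht0 n] with s hs
          by_cases h : s ∈ {s : ℕ → ℝ | ∑ k ∈ Finset.range n, s k ≤ t}
          · rw [Set.indicator_of_mem h]
            have hN := hs h
            refine ENNReal.ofReal_le_ofReal (le_trans ?_ (hlow _ (hn₁.trans hN)))
            gcongr
          · rw [Set.indicator_of_notMem h]
            exact zero_le

end Displacement

/-- Linear bounds give quadratic bounds for the Laplace transform. -/
theorem laplace_bounds {f : ℝ → ℝ≥0∞} {C D t₀ : ℝ} (hC : 0 < C) (hD : 0 < D) (ht₀ : 0 < t₀)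
    (hup : ∀ t, 0 < t → f t ≤ ENNReal.ofReal (D * t))
    (hlow : ∀ t, t₀ ≤ t → ENNReal.ofReal (C * t) ≤ f t) {lam : ℝ} (h0 : 0 < lam)
    (h1 : lam ≤ 1 / t₀) :
    ENNReal.ofReal (C * Real.exp (-2) * lam ^ (-2 : ℤ)) ≤
        ∫⁻ t in Set.Ioi (0 : ℝ), f t * ENNReal.ofReal (Real.exp (-lam * t)) ∧
      ∫⁻ t in Set.Ioi (0 : ℝ), f t * ENNReal.ofReal (Real.exp (-lam * t)) ≤
        ENNReal.ofReal (D * lam ^ (-2 : ℤ)) := by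
  have hz : lam ^ (-2 : ℤ) = 1 / lam * (1 / lam) := by
    rw [zpow_neg]; norm_cast; field_simp
  have ht1 : t₀ ≤ 1 / lam := by
    rw [le_div_iff₀ h0]
    rw [le_div_iff₀ ht₀] at h1
    linarith
  constructor
  -- The window from `1/lam` to `2/lam` suffices: its length is `1/lam`, and there `f ≥ C / lam` and
  -- the exponential is at least `exp (-2)`.
  · calc ENNReal.ofReal (C * Real.exp (-2) * lam ^ (-2 : ℤ))
        = ∫⁻ _ in Set.Ioc (1 / lam) (2 / lam), ENNReal.ofReal (C * (1 / lam) * Real.exp (-2)) := by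
          rw [setLIntegral_const, Real.volume_Ioc, ← ENNReal.ofReal_mul (by positivity), hz]
          congr 1
          ring
      _ ≤ ∫⁻ t in Set.Ioc (1 / lam) (2 / lam), f t * ENNReal.ofReal (Real.exp (-lam * t)) := by
          refine setLIntegral_mono' measurableSet_Ioc fun t ht => ?_
          rw [ENNReal.ofReal_mul (by positivity)]
          refine mul_le_mul' ((ENNReal.ofReal_le_ofReal ?_).trans (hlow t (ht1.trans ht.1.le)))
            (ENNReal.ofReal_le_ofReal (Real.exp_le_exp.2 ?_))
          · exact mul_le_mul_of_nonneg_left ht.1.le hC.le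
          · have := (le_div_iff₀ h0).1 ht.2
            linarith
      _ ≤ _ := lintegral_mono_set fun t ht => lt_trans (by positivity) ht.1
  -- The Gamma density of shape `2` is `lam² t exp (-lam t)`; its total mass one evaluates the
  -- integral of `t exp (-lam t)`.
  · have hm : Measurable (gammaPDF 2 lam) := (measurable_gammaPDFReal 2 lam).ennreal_ofReal
    calc ∫⁻ t in Set.Ioi (0 : ℝ), f t * ENNReal.ofReal (Real.exp (-lam * t))
        ≤ ∫⁻ t in Set.Ioi (0 : ℝ), ENNReal.ofReal (D * lam ^ (-2 : ℤ)) * gammaPDF 2 lam t := by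
          refine setLIntegral_mono' measurableSet_Ioi fun t ht => ?_
          have ht' : 0 < t := ht
          refine (mul_le_mul_left (hup t ht') _).trans (le_of_eq ?_)
          rw [gammaPDF_of_nonneg ht'.le, ← ENNReal.ofReal_mul (by positivity),
            ← ENNReal.ofReal_mul (by positivity), hz]
          congr 1
          rw [Real.Gamma_two, show (2 : ℝ) - 1 = 1 by norm_num, Real.rpow_one, Real.rpow_two,
            neg_mul]
          field_simp
      _ ≤ ∫⁻ t, ENNReal.ofReal (D * lam ^ (-2 : ℤ)) * gammaPDF 2 lam t := setLIntegral_le_lintegral _ _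
      _ = _ := by
          rw [lintegral_const_mul _ hm, lintegral_gammaPDF_eq_one (by norm_num) h0, mul_one]

end StoredMomentum

theorem theorem1p3 {d : ℕ} (hd : 3 ≤ d) (p : stdSimplex ℝ (Fin d)) (ε : ℝ≥0) (hε : 0 < ε)
    (M : StoredMomentum.Model) :
    (∃ C D : ℝ, 0 < C ∧ 0 < D ∧ ∀ᶠ lam in 𝓝[>] (0 : ℝ),
      ENNReal.ofReal (C * lam ^ (-2 : ℤ)) ≤ StoredMomentum.laplaceMSD M ε p lam ∧
      StoredMomentum.laplaceMSD M ε p lam ≤ ENNReal.ofReal (D * lam ^ (-2 : ℤ))) ∧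
    (∃ C' D' : ℝ, 0 < C' ∧ 0 < D' ∧ ∀ᶠ t in (atTop : Filter ℝ),
      ENNReal.ofReal (C' * t) ≤ StoredMomentum.meanSquareDisplacement M ε p t ∧
      StoredMomentum.meanSquareDisplacement M ε p t ≤ ENNReal.ofReal (D' * t)) := by
  obtain ⟨C, D, t₀, hC, hD, ht₀, hup, hlow⟩ :=
    StoredMomentum.exists_meanSquareDisplacement_bounds hd p M hε
  refine ⟨⟨C * Real.exp (-2), D, by positivity, hD, ?_⟩, C, D, hC, hD, ?_⟩
  · filter_upwards [Ioc_mem_nhdsGT (show (0 : ℝ) < 1 / t₀ by positivity)] with lam hlam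
    exact StoredMomentum.laplace_bounds hC hD ht₀ hup hlow hlam.1 hlam.2
  · filter_upwards [eventually_ge_atTop t₀] with t ht
    exact ⟨hlow t ht, hup t (ht₀.trans_le ht)⟩
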